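/- **Setting.** Let $\Sigma$ be a set of events, $\Sigma^{\le\omega}=\Sigma^*\cup\Sigma^\omega$, and for $A\subseteq\Sigma^*$ let $A^\omega\subseteq\Sigma^{\le\omega}$ be the set of all (finite or infinite) words $w_0w_1w_2\cdots$ with all $w_i\in A$. Expressions are $e::=o(a)\mid f\mid e_1;e_2\mid e_1\,?\,e_2$ with $a\in\Sigma$ and $f$ in a finite set $\mathcal F$ of (non-primitive) procedures; a program assigns to each $f\in\mathcal F$ an expression $e_f$. Over $\Sigma\uplus\{\checkmark\}$, let $e\Downarrow w$ and $e\Uparrow w$ ($w$ finite) be the least relations with: $o(a)\Downarrow a$; $o(a)\Uparrow a$; $e\Uparrow\epsilon$; $e_f\Downarrow w\Rightarrow f\Downarrow\checkmark w$; $e_f\Uparrow w\Rightarrow f\Uparrow\checkmark w$; $e_1\Downarrow w,\ e_2\Downarrow u\Rightarrow e_1;e_2\Downarrow wu$; $e_1\Downarrow w,\ e_2\Uparrow u\Rightarrow e_1;e_2\Uparrow wu$; $e_1\Uparrow w\Rightarrow e_1;e_2\Uparrow w$; and, for $i=1,2$, $e_i\Downarrow w\Rightarrow e_1?e_2\Downarrow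 w$ and $e_i\Uparrow w\Rightarrow e_1?e_2\Uparrow w$. Let $\theta$ delete all $\checkmark$. Write $e\downarrow w$ if $w=\theta(w')$ for some $w'$ with $e\Downarrow w'$, and $e\uparrow w$ if $w=\theta(w')$ for some infinite $w'$ all of whose finite prefixes $u$ satisfy $e\Uparrow u$. Let $T(f)=\{w\mid f\downarrow w\text{ or }f\uparrow w\}\subseteq\Sigma^{\le\omega}$. Let $\mathfrak A=(Q,\Sigma,\delta,q_0,F)$ be an extended Büchi automaton: $Q$ is finite, $\delta:Q\times\Sigma\to\mathcal P(Q)$, $q_0\in Q$, $F\subseteq Q$, and $L(\mathfrak A)\subseteq\Sigma^{\le\omega}$ consists of the finite words accepted by $\mathfrak A$ as an NFA and the infinite words accepted by $\mathfrak A$ as a Büchi automaton. For $w,u\in\Sigma^+$ put $w\sim u$ if for all states $p,q$ the words $w$ and $u$ agree on whether $q$ can be reached from $p$, and on whether $q$ can be reached from $p$ by a path that visits $F$ (end points included). Let $\mathcal Q=\Sigma^+/{\sim}\uplus\{[\epsilon]\}$ with $[\epsilon]=\{\epsilon\}$, a monoid under the concatenation of representatives, and $\mathcal C=\{(C,D)\in\mathcal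 Q^2\mid CD=C,\ DD=D\}$. Put $\mathfrak f(V)=\{(C,D)\in\mathcal C\mid CD^\omega\cap V\ne\emptyset\}$, $\mathfrak g(\mathcal V)=\bigcup_{(C,D)\in\mathcal V}CD^\omega$, $\mathfrak c(\mathcal V)=\bigcup_{n\ge1}(\mathfrak f\circ\mathfrak g)^n(\mathcal V)$, $\mathcal M_*=\mathcal P(\mathcal Q)$, $\mathcal M_{\le\omega}=\{\mathfrak c(\mathfrak f(V))\mid V\subseteq\Sigma^{\le\omega}\}$, $\alpha_*(U)=\{C\in\mathcal Q\mid C\cap U\neq\emptyset\}$, $\alpha_{\le\omega}=\mathfrak c\circ\mathfrak f$, $\gamma_*(\mathcal U)=\bigcup_{C\in\mathcal U}C$, $\gamma_{\le\omega}=\mathfrak g$. For $\mathcal U,\mathcal U',\mathcal A\in\mathcal M_*$ and $\mathcal V\in\mathcal M_{\le\omega}$ let $\mathcal U\cdot\mathcal U'=\{UU'\mid U\in\mathcal U,U'\in\mathcal U'\}$, $\mathcal U\cdot\mathcal V=\{(AC,D)\mid A\in\mathcal U,(C,D)\in\mathcal V\}$, let $\mathcal A^*$ be the submonoid of $\mathcal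 Q$ generated by $\mathcal A$, and $\mathcal A^\omega=\alpha_{\le\omega}(\gamma_*(\mathcal A)^\omega)$. Let $\mathfrak X$ be a set of variables that contains a separate variable for each procedure. Effect expressions are formal unions $\mathcal V(\mathfrak X)=\bigcup_{X\in\mathfrak X}\mathcal A_X\cdot X\cup\mathcal B$ with $\mathcal A_X\in\mathcal M_*$, $\mathcal B\in\mathcal M_{\le\omega}$, with union and left multiplication by elements of $\mathcal M_*$ defined coefficientwise; the variable $X$ stands for the expression with $\mathcal A_X=\{[\epsilon]\}$ and all else empty, and $\mathcal V(\mathfrak X-X)$ denotes an expression with $\mathcal A_X=\emptyset$. Environments $\Delta$ are sets of items $f\,\&\,(\mathcal U,X)$ in which different items have different variables. The judgements $\Delta\vdash_{\mathfrak A}e\,\&\,(\mathcal U,\mathcal V(\mathfrak X))$ are generated by the rules: 1. $\Delta\vdash_{\mathfrak A}o(a)\,\&\,(\alpha_*(\{a\}),\emptyset)$; 2. from $\Delta\vdash_{\mathfrak A}e_i\,\&\,(\mathcal U_i,\mathcal V_i(\mathfrak X))$ for $i=1,2$, infer $\Delta\vdash_{\mathfrak A}e_1;e_2\,\&\,(\mathcal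 U_1\cdot\mathcal U_2,\ \mathcal V_1(\mathfrak X)\cup\mathcal U_1\cdot\mathcal V_2(\mathfrak X))$ and $\Delta\vdash_{\mathfrak A}e_1?e_2\,\&\,(\mathcal U_1\cup\mathcal U_2,\ \mathcal V_1(\mathfrak X)\cup\mathcal V_2(\mathfrak X))$; 3. $\Delta\vdash_{\mathfrak A}f\,\&\,(\mathcal U,X)$ if $f\,\&\,(\mathcal U,X)$ is in $\Delta$; 4. from $\Delta,\,f\,\&\,(\mathcal U,X)\vdash_{\mathfrak A}e_f\,\&\,(\mathcal U,\ \mathcal A\cdot X\cup\mathcal V(\mathfrak X-X))$ with $X$ not used in $\Delta$, infer $\Delta\vdash_{\mathfrak A}f\,\&\,(\mathcal U,\ \mathcal A^*\cdot\mathcal V(\mathfrak X-X)\cup\mathcal A^\omega)$. **Theorem (Completeness).** For every program, every extended Büchi automaton $\mathfrak A$ over $\Sigma$ and every procedure $f\in\mathcal F$ there are $\mathcal U_f\in\mathcal M_*$ and $\mathcal V_f\in\mathcal M_{\le\omega}$ such that the judgement $\vdash_{\mathfrak A}f\,\&\,(\mathcal U_f,\mathcal V_f)$ is derivable from the empty environment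 and $$T(f)\subseteq L(\mathfrak A)\quad\Longleftrightarrow\quad\gamma_*(\mathcal U_f)\cup\gamma_{\le\omega}(\mathcal V_f)\subseteq L(\mathfrak A).$$ -/

import Mathlib

namespace BuchiEffect

/-! ### Finite and infinite words -/

/-- A trace over the alphabet `α`: a finite or an infinite word. -/
inductive Trace (α : Type*) where
  | fin : List α → Trace α
  | inf : (ℕ → α) → Trace α

namespace Trace

variable {α : Type*}

/-- `HasPrefix l w`: the finite word `l` is a prefix of the trace `w`. -/
def HasPrefix (l : List α) : Trace α → Prop
  | fin w => l <+: w
  | inf s => ∀ (i : ℕ) (h : i < l.length), l[i] = s i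

/-- Concatenation of a finite word with a trace. -/
def append (l : List α) : Trace α → Trace α
  | fin w => fin (l ++ w)
  | inf s => inf fun n => if h : n < l.length then l[n] else s (n - l.length)

/-- The finite word `u 0 ⬝ u 1 ⬝ … ⬝ u (n - 1)`. -/
def partialCat (u : ℕ → List α) (n : ℕ) : List α :=
  (List.range n).flatMap u

/-- `IsInfCat u w`: the (finite or infinite) trace `w` is the infinite concatenation
`u 0 ⬝ u 1 ⬝ u 2 ⬝ …`, that is, the finite prefixes of `w` are exactly the prefixes of the
words `u 0 ⬝ … ⬝ u (n - 1)`. Exactly one such `w` exists, see `existsUnique_isInfCat`. -/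
def IsInfCat (u : ℕ → List α) (w : Trace α) : Prop :=
  ∀ l : List α, HasPrefix l w ↔ ∃ n, l <+: partialCat u n

/-- The concatenation `A ⬝ V` of a language of finite words and a set of traces. -/
def catSet (A : Set (List α)) (V : Set (Trace α)) : Set (Trace α) :=
  {w | ∃ a ∈ A, ∃ v ∈ V, w = append a v}

/-- `A^ω`, the set of all `w₀w₁w₂…` with all `wᵢ ∈ A` (it contains finite words if `ε ∈ A`). -/
def omegaPow (A : Set (List α)) : Set (Trace α) :=
  {w | ∃ u : ℕ → List α, (∀ i, u i ∈ A) ∧ IsInfCat u w}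

/-! Elementary facts on words. -/

/-- The letter at position `i`, if there is one. -/
def get? : Trace α → ℕ → Option α
  | fin w, i => w[i]?
  | inf s, i => some (s i)

theorem get?_injective {v w : Trace α} (h : ∀ i, v.get? i = w.get? i) : v = w := by
  cases v with
  | fin v =>
    cases w with
    | fin w => exact congrArg fin (List.ext_getElem? h)
    | inf s => simpa [get?] using h v.length
  | inf r =>
    cases w with
    | fin w => simpa [get?] using h w.length
    | inf s => exact congrArg inf (funext fun i => by simpa [get?] using h i)

theorem hasPrefix_iff {l : List α} {w : Trace α} :
    HasPrefix l w ↔ ∀ i < l.length, l[i]? = w.get? i := by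
  cases w with
  | fin w =>
    simp only [HasPrefix, get?]
    exact List.prefix_iff_getElem?.trans
      ⟨fun h i hi => by rw [h i hi, List.getElem?_eq_getElem hi],
       fun h i hi => by rw [← h i hi, List.getElem?_eq_getElem hi]⟩
  | inf s =>
    simp only [HasPrefix, get?]
    exact ⟨fun h i hi => by rw [List.getElem?_eq_getElem hi, h i hi],
      fun h i hi => by simpa [List.getElem?_eq_getElem hi] using h i hi⟩

theorem get?_append (l : List α) (w : Trace α) (i : ℕ) :
    (append l w).get? i = if i < l.length then l[i]? else w.get? (i - l.length) := by
  cases w with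
  | fin w => simp only [append, get?]; exact List.getElem?_append
  | inf s =>
    simp only [append, get?]
    split_ifs with h
    · rw [List.getElem?_eq_getElem h]
    · rfl

theorem append_append (k l : List α) (w : Trace α) :
    append (k ++ l) w = append k (append l w) := by
  apply get?_injective
  intro i
  simp only [get?_append, List.length_append, List.getElem?_append]
  grind

theorem append_cancel {l : List α} {v w : Trace α} (h : append l v = append l w) : v = w := by
  apply get?_injective
  intro i
  have := congrArg (fun t => t.get? (l.length + i)) h
  simpa [get?_append] using this

theorem hasPrefix_append {k l : List α} {w : Trace α} :
    HasPrefix (k ++ l) (append k w) ↔ HasPrefix l w := by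
  simp only [hasPrefix_iff, get?_append, List.length_append, List.getElem?_append]
  constructor
  · intro h i hi
    have := h (k.length + i) (by omega)
    simpa using this
  · intro h i hi
    split_ifs with hk
    · rfl
    · exact h _ (by omega)

theorem hasPrefix_append_self (k : List α) (w : Trace α) : HasPrefix k (append k w) := by
  simp only [hasPrefix_iff, get?_append]
  intro i hi
  simp [hi]

theorem HasPrefix.of_prefix {k l : List α} {w : Trace α} (hkl : k <+: l)
    (h : HasPrefix l w) : HasPrefix k w := by
  rw [hasPrefix_iff] at h ⊢
  intro i hi
  rw [← h i (hi.trans_le hkl.length_le)]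
  obtain ⟨t, rfl⟩ := hkl
  exact (List.getElem?_append_left hi).symm

theorem HasPrefix.exists_append {l : List α} {w : Trace α} (h : HasPrefix l w) :
    ∃ r, w = append l r := by
  cases w with
  | fin w => obtain ⟨t, rfl⟩ := h; exact ⟨fin t, rfl⟩
  | inf s =>
    refine ⟨inf fun n => s (l.length + n), get?_injective fun i => ?_⟩
    rw [get?_append]
    split_ifs with hi
    · exact ((hasPrefix_iff.1 h) i hi).symm
    · simp only [get?]; congr 2; omega

theorem HasPrefix.total {k l : List α} {w : Trace α} (hk : HasPrefix k w) (hl : HasPrefix l w)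
    (hlen : k.length ≤ l.length) : k <+: l := by
  rw [hasPrefix_iff] at hk hl
  rw [List.prefix_iff_getElem?]
  intro i hi
  rw [hl i (hi.trans_le hlen), ← hk i hi, List.getElem?_eq_getElem hi]

theorem ext_hasPrefix {v w : Trace α} (h : ∀ l, HasPrefix l v ↔ HasPrefix l w) : v = w := by
  have key : ∀ {v w : Trace α}, (∀ l, HasPrefix l v → HasPrefix l w) →
      ∀ i a, v.get? i = some a → w.get? i = some a := by
    intro v w h i a hv
    have : ∃ l, HasPrefix l v ∧ i < l.length := by
      cases v with
      | fin v => exact ⟨v, List.prefix_rfl, (List.getElem?_eq_some_iff.1 hv).1⟩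
      | inf s => exact ⟨(List.range (i + 1)).map s, by simp [HasPrefix], by simp⟩
    obtain ⟨l, hl, hi⟩ := this
    rw [← hasPrefix_iff.1 (h l hl) i hi, hasPrefix_iff.1 hl i hi, hv]
  apply get?_injective
  intro i
  ext a
  exact ⟨key (fun l => (h l).1) i a, key (fun l => (h l).2) i a⟩

theorem partialCat_succ (u : ℕ → List α) (n : ℕ) :
    partialCat u (n + 1) = partialCat u n ++ u n := by
  simp [partialCat, List.range_succ]

theorem partialCat_add (u : ℕ → List α) (k n : ℕ) :
    partialCat u (k + n) = partialCat u k ++ partialCat (fun i => u (k + i)) n := by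
  induction n with
  | zero => simp [partialCat]
  | succ n ih => rw [← add_assoc, partialCat_succ, ih, partialCat_succ, List.append_assoc]

theorem partialCat_prefix (u : ℕ → List α) {m n : ℕ} (h : m ≤ n) :
    partialCat u m <+: partialCat u n := by
  obtain ⟨k, rfl⟩ := Nat.exists_eq_add_of_le h
  rw [partialCat_add]
  exact List.prefix_append _ _

/-- Infinite concatenations exist and are unique. -/
theorem existsUnique_isInfCat (u : ℕ → List α) : ∃! w, IsInfCat u w := by
  refine existsUnique_of_exists_of_unique ?_
    fun v w hv hw => ext_hasPrefix fun l => (hv l).trans (hw l).symm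
  by_cases hb : ∃ N, ∀ n, (partialCat u n).length ≤ (partialCat u N).length
  · obtain ⟨N, hN⟩ := hb
    refine ⟨fin (partialCat u N), fun l => ⟨fun h => ⟨N, h⟩, ?_⟩⟩
    rintro ⟨n, hn⟩
    refine hn.trans ?_
    rcases le_total n N with h | h
    · exact partialCat_prefix u h
    · rw [(partialCat_prefix u h).eq_of_length_le (hN n)]
  · push Not at hb
    have hlen : ∀ k, ∃ n, k < (partialCat u n).length := by
      intro k
      induction k with
      | zero => obtain ⟨n, hn⟩ := hb 0; exact ⟨n, by omega⟩
      | succ k ih =>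
        obtain ⟨m, hm⟩ := ih
        obtain ⟨n, hn⟩ := hb m
        exact ⟨n, by omega⟩
    choose N hN using hlen
    have hs : ∀ n, HasPrefix (partialCat u n) (inf fun k => (partialCat u (N k))[k]'(hN k)) := by
      intro n i hi
      rcases le_total n (N i) with h | h
      · exact (partialCat_prefix u h).getElem hi
      · exact ((partialCat_prefix u h).getElem (hN i)).symm
    refine ⟨_, fun l => ⟨fun h => ⟨N l.length, h.total (hs _) (hN _).le⟩, ?_⟩⟩
    rintro ⟨n, hn⟩
    exact (hs n).of_prefix hn

theorem IsInfCat.hasPrefix {u : ℕ → List α} {w : Trace α} (h : IsInfCat u w) (n : ℕ) :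
    HasPrefix (partialCat u n) w :=
  (h _).2 ⟨n, List.prefix_rfl⟩

/-- Splitting off the first `k` factors of an infinite concatenation. -/
theorem IsInfCat.drop {u : ℕ → List α} {w : Trace α} (h : IsInfCat u w) (k : ℕ) :
    ∃ r, w = append (partialCat u k) r ∧ IsInfCat (fun i => u (k + i)) r := by
  obtain ⟨r, rfl⟩ := (h.hasPrefix k).exists_append
  refine ⟨r, rfl, fun l => ?_⟩
  rw [← hasPrefix_append (k := partialCat u k), h]
  constructor
  · rintro ⟨n, hn⟩
    refine ⟨n, ?_⟩
    rw [← List.prefix_append_right_inj (partialCat u k), ← partialCat_add]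
    exact hn.trans (partialCat_prefix u (by omega))
  · rintro ⟨n, hn⟩
    refine ⟨k + n, ?_⟩
    rw [partialCat_add]
    exact (List.prefix_append_right_inj _).2 hn

end Trace

/-! ### Programs and their traces -/

/-- Expressions over events `Ev` and (non-primitive) procedure identifiers `Proc`:
`o(a)`, a procedure call, `e₁ ; e₂` and the nondeterministic choice `e₁ ? e₂`. -/
inductive Expr (Ev Proc : Type*) where
  | out : Ev → Expr Ev Proc
  | call : Proc → Expr Ev Proc
  | seq : Expr Ev Proc → Expr Ev Proc → Expr Ev Proc
  | choice : Expr Ev Proc → Expr Ev Proc → Expr Ev Proc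

/-- A program assigns to every procedure identifier its defining expression. -/
abbrev Program (Ev Proc : Type*) := Proc → Expr Ev Proc

section Semantics

variable {Ev Proc : Type*}

/-- Observed extended semantics of terminating executions, `e ⇓ w`. The tick event is `none`, an
event `a` is `some a`. Every procedure call issues a tick. -/
inductive Terminates (P : Program Ev Proc) : Expr Ev Proc → List (Option Ev) → Prop
  | out (a : Ev) : Terminates P (.out a) [some a]
  | call {f : Proc} {w} : Terminates P (P f) w → Terminates P (.call f) (none :: w)
  | seq {e₁ e₂ w u} : Terminates P e₁ w → Terminates P e₂ u → Terminates P (.seq e₁ e₂) (w ++ u)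
  | choice_left {e₁ e₂ w} : Terminates P e₁ w → Terminates P (.choice e₁ e₂) w
  | choice_right {e₁ e₂ w} : Terminates P e₂ w → Terminates P (.choice e₁ e₂) w

/-- Observed extended semantics of partial executions, `e ⇑ w`. -/
inductive Observes (P : Program Ev Proc) : Expr Ev Proc → List (Option Ev) → Prop
  | out (a : Ev) : Observes P (.out a) [some a]
  | nil (e : Expr Ev Proc) : Observes P e []
  | call {f : Proc} {w} : Observes P (P f) w → Observes P (.call f) (none :: w)
  | seq_right {e₁ e₂ w u} : Terminates P e₁ w → Observes P e₂ u → Observes P (.seq e₁ e₂) (w ++ u)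
  | seq_left {e₁ e₂ w} : Observes P e₁ w → Observes P (.seq e₁ e₂) w
  | choice_left {e₁ e₂ w} : Observes P e₁ w → Observes P (.choice e₁ e₂) w
  | choice_right {e₁ e₂ w} : Observes P e₂ w → Observes P (.choice e₁ e₂) w

/-- `IsErasure s w`: removing all ticks from the infinite extended word `s` yields the (finite or
infinite) trace `w`. -/
def IsErasure (s : ℕ → Option Ev) (w : Trace Ev) : Prop :=
  Trace.IsInfCat (fun i => (s i).toList) w

/-- `e ↓ w`: some terminating execution of `e` has the trace `w`. -/
def TermTrace (P : Program Ev Proc) (e : Expr Ev Proc) (w : List Ev) : Prop :=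
  ∃ w', Terminates P e w' ∧ w = w'.reduceOption

/-- `e ↑ w`: some nonterminating execution of `e` has the trace `w`. -/
def NontermTrace (P : Program Ev Proc) (e : Expr Ev Proc) (w : Trace Ev) : Prop :=
  ∃ s : ℕ → Option Ev, (∀ u, Trace.HasPrefix u (.inf s) → Observes P e u) ∧ IsErasure s w

/-- The set `T(f)` of all traces of the procedure `f`. -/
def traces (P : Program Ev Proc) (f : Proc) : Set (Trace Ev) :=
  {w | (∃ l, w = .fin l ∧ TermTrace P (.call f) l) ∨ NontermTrace P (.call f) w}

end Semantics

/-! ### Extended Büchi automata -/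

/-- An extended Büchi automaton with state set `Q` over the alphabet `Ev`. -/
structure ExtBuchi (Q Ev : Type*) where
  /-- transition function -/
  δ : Q → Ev → Set Q
  /-- initial state -/
  q₀ : Q
  /-- final states -/
  F : Set Q

namespace ExtBuchi

variable {Q Ev : Type*} (𝔄 : ExtBuchi Q Ev)

/-- `Reach p w q`: the state `q` is reachable from `p` by the finite word `w`. -/
def Reach : Q → List Ev → Q → Prop
  | p, [], q => p = q
  | p, a :: w, q => ∃ r ∈ 𝔄.δ p a, Reach r w q

/-- Reachability visiting a final state on the way (end points included). -/
def ReachF (p : Q) (w : List Ev) (q : Q) : Prop :=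
  ∃ r ∈ 𝔄.F, ∃ u v, w = u ++ v ∧ 𝔄.Reach p u r ∧ 𝔄.Reach r v q

/-- Acceptance: of finite words as by an NFA, of infinite words as by a Büchi automaton. -/
def Accepts : Trace Ev → Prop
  | .fin w => ∃ q ∈ 𝔄.F, 𝔄.Reach 𝔄.q₀ w q
  | .inf s => ∃ ρ : ℕ → Q, ρ 0 = 𝔄.q₀ ∧ (∀ n, ρ (n + 1) ∈ 𝔄.δ (ρ n) (s n)) ∧
      ∀ n, ∃ m, n ≤ m ∧ ρ m ∈ 𝔄.F

/-- The language `L(𝔄)`. -/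
def lang : Set (Trace Ev) := {w | 𝔄.Accepts w}

/-- The relation `w ∼ u` (used for nonempty words). -/
def Sim (w u : List Ev) : Prop :=
  ∀ p q, (𝔄.Reach p w q ↔ 𝔄.Reach p u q) ∧ (𝔄.ReachF p w q ↔ 𝔄.ReachF p u q)

theorem reach_append {p q : Q} {w u : List Ev} :
    𝔄.Reach p (w ++ u) q ↔ ∃ r, 𝔄.Reach p w r ∧ 𝔄.Reach r u q := by
  induction w generalizing p with
  | nil => simp [Reach]
  | cons a w ih => simp only [List.cons_append, Reach, ih]; grind

theorem reachF_append {p q : Q} {w u : List Ev} :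
    𝔄.ReachF p (w ++ u) q ↔
      ∃ r, (𝔄.ReachF p w r ∧ 𝔄.Reach r u q) ∨ (𝔄.Reach p w r ∧ 𝔄.ReachF r u q) := by
  constructor
  · rintro ⟨r, hr, x, y, hxy, h₁, h₂⟩
    rcases List.append_eq_append_iff.1 hxy with ⟨z, rfl, rfl⟩ | ⟨z, rfl, rfl⟩
    · obtain ⟨s, hs, hs'⟩ := 𝔄.reach_append.1 h₁
      exact ⟨s, .inr ⟨hs, r, hr, z, y, rfl, hs', h₂⟩⟩
    · obtain ⟨s, hs, hs'⟩ := 𝔄.reach_append.1 h₂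
      exact ⟨s, .inl ⟨⟨r, hr, x, z, rfl, h₁, hs⟩, hs'⟩⟩
  · rintro ⟨s, ⟨⟨r, hr, x, y, rfl, h₁, h₂⟩, h₃⟩ | ⟨h₁, r, hr, x, y, rfl, h₂, h₃⟩⟩
    · exact ⟨r, hr, x, y ++ u, List.append_assoc .., h₁, 𝔄.reach_append.2 ⟨s, h₂, h₃⟩⟩
    · exact ⟨r, hr, w ++ x, y, (List.append_assoc ..).symm, 𝔄.reach_append.2 ⟨s, h₁, h₂⟩, h₃⟩

theorem Sim.append {w w' u u' : List Ev} (h : 𝔄.Sim w u) (h' : 𝔄.Sim w' u') :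
    𝔄.Sim (w ++ w') (u ++ u') := by
  intro p q
  simp only [reach_append, reachF_append, (h _ _).1, (h _ _).2, (h' _ _).1, (h' _ _).2, and_self]

/-- The congruence on the free monoid whose classes are the `∼`-classes of nonempty words and the
additional class `{ε}`. -/
def con : Con (FreeMonoid Ev) where
  r w u := (w.toList = [] ∧ u.toList = []) ∨
    (w.toList ≠ [] ∧ u.toList ≠ [] ∧ 𝔄.Sim w.toList u.toList)
  iseqv :=
    { refl := fun w => by
        by_cases h : w.toList = []
        · exact .inl ⟨h, h⟩
        · exact .inr ⟨h, h, fun _ _ => ⟨Iff.rfl, Iff.rfl⟩⟩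
      symm := fun h => by
        rcases h with ⟨h₁, h₂⟩ | ⟨h₁, h₂, h₃⟩
        · exact .inl ⟨h₂, h₁⟩
        · exact .inr ⟨h₂, h₁, fun p q => ⟨(h₃ p q).1.symm, (h₃ p q).2.symm⟩⟩
      trans := fun h k => by
        rcases h with ⟨h₁, h₂⟩ | ⟨h₁, h₂, h₃⟩ <;> rcases k with ⟨k₁, k₂⟩ | ⟨k₁, k₂, k₃⟩
        · exact .inl ⟨h₁, k₂⟩
        · exact absurd h₂ k₁
        · exact absurd k₁ h₂
        · exact .inr ⟨h₁, k₂, fun p q => ⟨(h₃ p q).1.trans (k₃ p q).1,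
            (h₃ p q).2.trans (k₃ p q).2⟩⟩ }
  mul' := fun {w x y z} h k => by
    simp only [FreeMonoid.toList_mul]
    rcases h with ⟨h₁, h₂⟩ | ⟨h₁, h₂, h₃⟩ <;> rcases k with ⟨k₁, k₂⟩ | ⟨k₁, k₂, k₃⟩
    · exact .inl ⟨by simp [h₁, k₁], by simp [h₂, k₂]⟩
    · exact .inr ⟨by simp [k₁], by simp [k₂], by simpa [h₁, h₂] using k₃⟩
    · exact .inr ⟨by simp [h₁], by simp [h₂], by simpa [k₁, k₂] using h₃⟩
    · exact .inr ⟨by simp [h₁], by simp [h₂], h₃.append 𝔄 k₃⟩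

/-- The monoid of classes, `Σ⁺/∼ ⊎ {[ε]}`. -/
abbrev Cls := 𝔄.con.Quotient

/-- The class `[w]` of a finite word. -/
def cls (w : List Ev) : 𝔄.Cls := ((FreeMonoid.ofList w : FreeMonoid Ev) : 𝔄.con.Quotient)

/-- A class as a set of words. -/
def words (C : 𝔄.Cls) : Set (List Ev) := {w | 𝔄.cls w = C}

theorem cls_append (w u : List Ev) : 𝔄.cls (w ++ u) = 𝔄.cls w * 𝔄.cls u := rfl

theorem words_nonempty (C : 𝔄.Cls) : ∃ w, 𝔄.cls w = C := by
  obtain ⟨w, rfl⟩ := Con.mk'_surjective C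
  exact ⟨w.toList, rfl⟩

/-! ### The Büchi abstraction -/

/-- The set `𝒞` of pairs of classes `(C, D)` with `CD = C` and `DD = D`. -/
abbrev LPair := {p : 𝔄.Cls × 𝔄.Cls // p.1 * p.2 = p.1 ∧ p.2 * p.2 = p.2}

/-- The set of traces `C D^ω`. -/
def lasso (p : 𝔄.LPair) : Set (Trace Ev) :=
  Trace.catSet (𝔄.words p.1.1) (Trace.omegaPow (𝔄.words p.1.2))

/-- The pre-abstraction `𝔣`. -/
def preAbs (V : Set (Trace Ev)) : Set 𝔄.LPair := {p | (𝔄.lasso p ∩ V).Nonempty}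

/-- The pre-concretization `𝔤`. -/
def preConc (𝒱 : Set 𝔄.LPair) : Set (Trace Ev) := ⋃ p ∈ 𝒱, 𝔄.lasso p

/-- The closure `𝔠(𝒱)`, the union of all `(𝔣 ∘ 𝔤)ⁿ(𝒱)` with `n ≥ 1`. -/
def clos (𝒱 : Set 𝔄.LPair) : Set 𝔄.LPair :=
  ⋃ n : ℕ, (fun 𝒲 => 𝔄.preAbs (𝔄.preConc 𝒲))^[n + 1] 𝒱

/-- The abstract domain `ℳ_*`: sets of classes. -/
abbrev MStar := Set 𝔄.Cls

/-- The abstract domain `ℳ_{≤ω}`: the sets `𝔠(𝔣(V))` with `V` a set of traces. -/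
abbrev MOmega := {𝒱 : Set 𝔄.LPair // ∃ V : Set (Trace Ev), 𝒱 = 𝔄.clos (𝔄.preAbs V)}

/-- Abstraction `α_*`. -/
def alphaStar (U : Set (List Ev)) : 𝔄.MStar := {C | (𝔄.words C ∩ U).Nonempty}

/-- Concretization `γ_*`. -/
def gammaStar (𝒰 : 𝔄.MStar) : Set (List Ev) := ⋃ C ∈ 𝒰, 𝔄.words C

/-- Abstraction `α_{≤ω}`. -/
def alphaOmega (V : Set (Trace Ev)) : 𝔄.MOmega := ⟨𝔄.clos (𝔄.preAbs V), V, rfl⟩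

/-- Concretization `γ_{≤ω}`. -/
def gammaOmega (𝒱 : 𝔄.MOmega) : Set (Trace Ev) := 𝔄.preConc 𝒱.1

/-! The members of `ℳ_{≤ω}` are the closed sets of pairs; they are stable under the operations. -/

theorem lasso_nonempty (p : 𝔄.LPair) : (𝔄.lasso p).Nonempty := by
  obtain ⟨c, hc⟩ := 𝔄.words_nonempty p.1.1
  obtain ⟨d, hd⟩ := 𝔄.words_nonempty p.1.2
  obtain ⟨t, ht, -⟩ := Trace.existsUnique_isInfCat fun _ : ℕ => d
  exact ⟨_, c, hc, t, ⟨fun _ => d, fun _ => hd, ht⟩, rfl⟩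

theorem mem_preAbs_preConc {𝒱 : Set 𝔄.LPair} {p : 𝔄.LPair} :
    p ∈ 𝔄.preAbs (𝔄.preConc 𝒱) ↔ ∃ q ∈ 𝒱, (𝔄.lasso p ∩ 𝔄.lasso q).Nonempty := by
  simp only [preAbs, preConc, Set.Nonempty, Set.mem_inter_iff, Set.mem_iUnion, Set.mem_ofPred_eq]
  grind

theorem mem_MOmega_iff {𝒱 : Set 𝔄.LPair} :
    (∃ V : Set (Trace Ev), 𝒱 = 𝔄.clos (𝔄.preAbs V)) ↔
      ∀ p q, q ∈ 𝒱 → (𝔄.lasso p ∩ 𝔄.lasso q).Nonempty → p ∈ 𝒱 := by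
  constructor
  · rintro ⟨V, rfl⟩ p q hq hpq
    obtain ⟨n, hn⟩ := Set.mem_iUnion.1 hq
    refine Set.mem_iUnion.2 ⟨n + 1, ?_⟩
    rw [Function.iterate_succ_apply']
    exact 𝔄.mem_preAbs_preConc.2 ⟨q, hn, hpq⟩
  · intro h
    have hfix : 𝔄.preAbs (𝔄.preConc 𝒱) = 𝒱 := by
      ext p
      rw [mem_preAbs_preConc]
      refine ⟨fun ⟨q, hq, hpq⟩ => h p q hq hpq, fun hp => ⟨p, hp, ?_⟩⟩
      simpa using 𝔄.lasso_nonempty p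
    refine ⟨𝔄.preConc 𝒱, ?_⟩
    rw [hfix, clos]
    have : ∀ n : ℕ, (fun 𝒲 => 𝔄.preAbs (𝔄.preConc 𝒲))^[n + 1] 𝒱 = 𝒱 := fun n =>
      Function.iterate_fixed (f := fun 𝒲 => 𝔄.preAbs (𝔄.preConc 𝒲)) hfix (n + 1)
    simp only [this, Set.iUnion_const]

/-- The empty element of `ℳ_{≤ω}`. -/
def omegaEmpty : 𝔄.MOmega := ⟨∅, 𝔄.mem_MOmega_iff.2 fun _ _ h => h.elim⟩

/-- Union on `ℳ_{≤ω}`. -/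
def omegaUnion (𝒱 𝒲 : 𝔄.MOmega) : 𝔄.MOmega :=
  ⟨𝒱.1 ∪ 𝒲.1, 𝔄.mem_MOmega_iff.2 fun p q hq hpq =>
    hq.imp (fun h => 𝔄.mem_MOmega_iff.1 𝒱.2 p q h hpq)
      (fun h => 𝔄.mem_MOmega_iff.1 𝒲.2 p q h hpq)⟩

/-- Concatenation on `ℳ_*`. -/
def starCat (𝒰 𝒰' : 𝔄.MStar) : 𝔄.MStar := {C | ∃ A ∈ 𝒰, ∃ B ∈ 𝒰', C = A * B}

/-- The set of pairs `(AC, D)` with `A ∈ 𝒰` and `(C, D) ∈ 𝒱`. -/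
def catPairs (𝒰 : 𝔄.MStar) (𝒱 : Set 𝔄.LPair) : Set 𝔄.LPair :=
  {p | ∃ A ∈ 𝒰, ∃ q ∈ 𝒱, p.1.1 = A * q.1.1 ∧ p.1.2 = q.1.2}

theorem cls_append_partialCat {U V : 𝔄.Cls} (hUV : U * V = U) {c : List Ev} {d : ℕ → List Ev}
    (hc : 𝔄.cls c = U) (hd : ∀ i, 𝔄.cls (d i) = V) (k : ℕ) :
    𝔄.cls (c ++ Trace.partialCat d k) = U := by
  induction k with
  | zero => simpa [Trace.partialCat] using hc
  | succ k ih => rw [Trace.partialCat_succ, ← List.append_assoc, cls_append, ih, hd, hUV]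

theorem catPairs_mem (𝒰 : 𝔄.MStar) (𝒱 : 𝔄.MOmega) :
    ∃ V : Set (Trace Ev), 𝔄.catPairs 𝒰 𝒱.1 = 𝔄.clos (𝔄.preAbs V) := by
  rw [mem_MOmega_iff]
  rintro p r ⟨A, hA, q, hq, hr₁, hr₂⟩ ⟨w, ⟨c, hc, t, ⟨d, hd, ht⟩, rfl⟩, z, hz, t₁, ht₁, hw⟩
  simp only [words, Set.mem_ofPred_eq] at hc hd hz
  -- some `c ++ partialCat d k` extends `z`
  obtain ⟨k, y, hk⟩ : ∃ k y, c ++ Trace.partialCat d k = z ++ y := by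
    have hzw : Trace.HasPrefix z (Trace.append c t) := hw ▸ Trace.hasPrefix_append_self z t₁
    rcases le_total z.length c.length with h | h
    · obtain ⟨y, hy⟩ := hzw.total (Trace.hasPrefix_append_self c t) h
      exact ⟨0, y, by simp [Trace.partialCat, hy]⟩
    · obtain ⟨x, rfl⟩ := (Trace.hasPrefix_append_self c t).total hzw h
      obtain ⟨n, y, hn⟩ := (ht x).1 (Trace.hasPrefix_append.1 hzw)
      exact ⟨n, y, by rw [← hn, List.append_assoc]⟩
  obtain ⟨s, hs, hs'⟩ := ht.drop (k + 1)
  have ht₁' : t₁ = Trace.append (y ++ d k) s := by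
    apply Trace.append_cancel (l := z)
    rw [← hw, hs, ← Trace.append_append, ← Trace.append_append, Trace.partialCat_succ,
      ← List.append_assoc, hk, List.append_assoc]
  obtain ⟨c₁, hc₁⟩ := 𝔄.words_nonempty q.1.1
  let q' : 𝔄.LPair := ⟨(q.1.1 * 𝔄.cls y * p.1.2, p.1.2), by rw [mul_assoc, p.2.2], p.2.2⟩
  have hq' : q' ∈ 𝒱.1 := by
    refine 𝔄.mem_MOmega_iff.1 𝒱.2 q' q hq ⟨Trace.append c₁ t₁, ?_, ?_⟩
    · refine ⟨c₁ ++ (y ++ d k), ?_, s, ⟨_, fun i => hd _, hs'⟩, ?_⟩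
      · simp only [words, Set.mem_ofPred_eq, cls_append, hc₁, hd, q', mul_assoc]
      · rw [Trace.append_append, ht₁']
    · exact ⟨c₁, hc₁, t₁, hr₂ ▸ ht₁, rfl⟩
  refine ⟨A, hA, q', hq', ?_, rfl⟩
  have h₁ := 𝔄.cls_append_partialCat p.2.1 hc hd k
  rw [hk, cls_append, hz, hr₁] at h₁
  simp only [q', ← mul_assoc]
  rw [h₁, p.2.1]

/-- Concatenation `ℳ_* × ℳ_{≤ω} → ℳ_{≤ω}`. -/
def omegaCat (𝒰 : 𝔄.MStar) (𝒱 : 𝔄.MOmega) : 𝔄.MOmega :=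
  ⟨𝔄.catPairs 𝒰 𝒱.1, 𝔄.catPairs_mem 𝒰 𝒱⟩

/-- Finite iteration `𝒜^*` on `ℳ_*`: all finite products of members of `𝒜`. -/
def starIter (𝒜 : 𝔄.MStar) : 𝔄.MStar := (Submonoid.closure 𝒜 : Set 𝔄.Cls)

/-- Infinite iteration `𝒜^ω = α_{≤ω}(γ_*(𝒜)^ω)`. -/
def omegaIter (𝒜 : 𝔄.MStar) : 𝔄.MOmega :=
  𝔄.alphaOmega (Trace.omegaPow (𝔄.gammaStar 𝒜))

end ExtBuchi

/-! ### The Büchi type and effect system -/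

/-- An effect expression `⋃_X (𝒜_X ⬝ X) ∪ ℬ` over the variables `Var`. -/
structure EffExpr {Q Ev : Type*} (𝔄 : ExtBuchi Q Ev) (Var : Type*) where
  /-- the coefficients `𝒜_X` -/
  coeff : Var → 𝔄.MStar
  /-- the constant part `ℬ` -/
  base : 𝔄.MOmega

namespace EffExpr

variable {Q Ev Var : Type*} {𝔄 : ExtBuchi Q Ev}

/-- The variable-free expression `𝒱`. -/
def const (𝒱 : 𝔄.MOmega) : EffExpr 𝔄 Var := ⟨fun _ => ∅, 𝒱⟩

open Classical in
/-- The expression `X`. -/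
noncomputable def var (X : Var) : EffExpr 𝔄 Var :=
  ⟨fun Y => if Y = X then {1} else ∅, 𝔄.omegaEmpty⟩

/-- The union of two expressions. -/
def union (𝒱 𝒲 : EffExpr 𝔄 Var) : EffExpr 𝔄 Var :=
  ⟨fun X => 𝒱.coeff X ∪ 𝒲.coeff X, 𝔄.omegaUnion 𝒱.base 𝒲.base⟩

/-- The expression `𝒜 ⬝ 𝒱`. -/
def cat (𝒜 : 𝔄.MStar) (𝒱 : EffExpr 𝔄 Var) : EffExpr 𝔄 Var :=
  ⟨fun X => 𝔄.starCat 𝒜 (𝒱.coeff X), 𝔄.omegaCat 𝒜 𝒱.base⟩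

/-- The variable `X` does not occur, that is, the expression has the form `𝒱(𝔛 - X)`. -/
def Avoids (𝒱 : EffExpr 𝔄 Var) (X : Var) : Prop := 𝒱.coeff X = ∅

end EffExpr

/-- An item `f & (𝒰, X)` of an environment. -/
structure Binding {Q Ev : Type*} (𝔄 : ExtBuchi Q Ev) (Proc Var : Type*) where
  /-- the procedure `f` -/
  proc : Proc
  /-- the effect `𝒰` of its terminating executions -/
  eff : 𝔄.MStar
  /-- the variable `X` -/
  var : Var

/-- Environments: sets of bindings in which different bindings have different variables. -/
structure Env {Q Ev : Type*} (𝔄 : ExtBuchi Q Ev) (Proc Var : Type*) where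
  /-- the bindings -/
  items : Set (Binding 𝔄 Proc Var)
  /-- different bindings have different variables -/
  distinct : ∀ b ∈ items, ∀ b' ∈ items, b.var = b'.var → b = b'

namespace Env

variable {Q Ev Proc Var : Type*} {𝔄 : ExtBuchi Q Ev}

/-- The empty environment. -/
def empty : Env 𝔄 Proc Var := ⟨∅, fun _ h => h.elim⟩

/-- The variable `X` is not used in the environment. -/
def Fresh (Δ : Env 𝔄 Proc Var) (X : Var) : Prop := ∀ b ∈ Δ.items, b.var ≠ X

/-- The environment `Δ, f & (𝒰, X)`. -/
def extend (Δ : Env 𝔄 Proc Var) (f : Proc) (𝒰 : 𝔄.MStar) (X : Var) (h : Δ.Fresh X) :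
    Env 𝔄 Proc Var where
  items := insert ⟨f, 𝒰, X⟩ Δ.items
  distinct := by
    rintro b (rfl | hb) b' (rfl | hb') e
    · rfl
    · exact absurd e.symm (h b' hb')
    · exact absurd e (h b hb)
    · exact Δ.distinct b hb b' hb' e

end Env

/-- The judgements `Δ ⊢_𝔄 e & (𝒰, 𝒱(𝔛))` for the program `P`. -/
inductive Derives {Q Ev Proc Var : Type*} (𝔄 : ExtBuchi Q Ev) (P : Program Ev Proc) :
    Env 𝔄 Proc Var → Expr Ev Proc → 𝔄.MStar → EffExpr 𝔄 Var → Prop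
  | out (Δ : Env 𝔄 Proc Var) (a : Ev) :
      Derives 𝔄 P Δ (.out a) (𝔄.alphaStar {[a]}) (.const 𝔄.omegaEmpty)
  | seq {Δ : Env 𝔄 Proc Var} {e₁ e₂ 𝒰₁ 𝒰₂ 𝒱₁ 𝒱₂} :
      Derives 𝔄 P Δ e₁ 𝒰₁ 𝒱₁ → Derives 𝔄 P Δ e₂ 𝒰₂ 𝒱₂ →
      Derives 𝔄 P Δ (.seq e₁ e₂) (𝔄.starCat 𝒰₁ 𝒰₂) (𝒱₁.union (𝒱₂.cat 𝒰₁))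
  | choice {Δ : Env 𝔄 Proc Var} {e₁ e₂ 𝒰₁ 𝒰₂ 𝒱₁ 𝒱₂} :
      Derives 𝔄 P Δ e₁ 𝒰₁ 𝒱₁ → Derives 𝔄 P Δ e₂ 𝒰₂ 𝒱₂ →
      Derives 𝔄 P Δ (.choice e₁ e₂) (𝒰₁ ∪ 𝒰₂) (𝒱₁.union 𝒱₂)
  | hyp {Δ : Env 𝔄 Proc Var} {f : Proc} {𝒰 : 𝔄.MStar} {X : Var} :
      ⟨f, 𝒰, X⟩ ∈ Δ.items → Derives 𝔄 P Δ (.call f) 𝒰 (.var X)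
  | fix {Δ : Env 𝔄 Proc Var} {f : Proc} {𝒰 : 𝔄.MStar} {X : Var} {𝒜 : 𝔄.MStar}
      {𝒱 : EffExpr 𝔄 Var} (hX : Δ.Fresh X) (h𝒱 : 𝒱.Avoids X) :
      Derives 𝔄 P (Δ.extend f 𝒰 X hX) (P f) 𝒰 (((EffExpr.var X).cat 𝒜).union 𝒱) →
      Derives 𝔄 P Δ (.call f) 𝒰 ((𝒱.cat (𝔄.starIter 𝒜)).union (.const (𝔄.omegaIter 𝒜)))

end BuchiEffect

/-!
A nonterminating execution enters infinitely many calls that never return, one inside the other, and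
is the concatenation of the finite pieces between them. For a set `S` of procedures, an expression
`e` thus has an exact effect over the variables of `S`: the traces of its terminating executions,
for each `g ∈ S` the language `R_S(e, g)` of its runs up to a call of `g`, and the set `D_S(e)` of
its infinite runs, where runs stay in no call of a procedure in `S`. Adding `f` to `S` is a step of
Kleene's state elimination: for `f ∉ S` and `L = R_{S ∪ {f}}(e_f, f)`,

`R_S(e_f, g) = L∗ R_{S ∪ {f}}(e_f, g)` and `D_S(e_f) = L∗ D_{S ∪ {f}}(e_f) ∪ L^ω`,

which is rule 4 before abstraction. The abstractions commute with union, concatenation, `∗` and `ω`,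
because by Ramsey's theorem every infinite concatenation of words lies in a lasso `C D^ω` that
depends only on the classes of the words. Hence the rules derive the abstraction of the exact effect
of every expression, by induction on the complement of `S`. Finally, a lasso is either contained in
`L(𝔄)` or disjoint from it, so `γ ∘ α` enlarges a set of traces without affecting whether it is
contained in `L(𝔄)`.
-/

namespace BuchiEffect

open scoped Computability

namespace Trace

open Filter (atTop)

variable {α β : Type*}

theorem append_nil (w : Trace α) : append [] w = w := by
  apply get?_injective
  simp [get?_append]

theorem partialCat_append_flatMap_Ico (u : ℕ → List α) {a b : ℕ} (h : a ≤ b) :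
    partialCat u a ++ (List.Ico a b).flatMap u = partialCat u b := by
  rw [partialCat, partialCat, ← List.flatMap_append, ← List.Ico.zero_bot, ← List.Ico.zero_bot,
    List.Ico.append_consecutive a.zero_le h]

theorem IsInfCat.unique {u : ℕ → List α} {v w : Trace α} (hv : IsInfCat u v) (hw : IsInfCat u w) :
    v = w :=
  (existsUnique_isInfCat u).unique hv hw

theorem isInfCat_congr {u v : ℕ → List α} (huv : ∀ n, ∃ m, partialCat u n <+: partialCat v m)
    (hvu : ∀ n, ∃ m, partialCat v n <+: partialCat u m) {w : Trace α} :
    IsInfCat u w ↔ IsInfCat v w := by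
  refine forall_congr' fun l => iff_congr Iff.rfl ⟨?_, ?_⟩
  · rintro ⟨n, hn⟩
    exact (huv n).imp fun m hm => hn.trans hm
  · rintro ⟨n, hn⟩
    exact (hvu n).imp fun m hm => hn.trans hm

theorem isInfCat_group {u : ℕ → List α} {k : ℕ → ℕ} (hk : StrictMono k) (hk₀ : k 0 = 0)
    {w : Trace α} :
    IsInfCat (fun i => (List.Ico (k i) (k (i + 1))).flatMap u) w ↔ IsInfCat u w := by
  have group (n : ℕ) : partialCat (fun i => (List.Ico (k i) (k (i + 1))).flatMap u) n =
      partialCat u (k n) := by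
    induction n with
    | zero => simp [hk₀, partialCat]
    | succ n ih =>
      rw [partialCat_succ, ih, partialCat_append_flatMap_Ico u (hk.monotone n.le_succ)]
  exact isInfCat_congr (fun n => ⟨k n, group n ▸ List.prefix_rfl⟩)
    fun n => ⟨n, group n ▸ partialCat_prefix u hk.le_apply⟩

theorem IsInfCat.tail {u : ℕ → List α} {w : Trace α} (hw : IsInfCat u w) :
    ∃ r, w = append (u 0) r ∧ IsInfCat (fun i => u (i + 1)) r := by
  simpa [partialCat, add_comm] using hw.drop 1

theorem IsInfCat.cons {u : ℕ → List α} {w : Trace α} (hw : IsInfCat u w) (l : List α) :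
    IsInfCat (fun i => i.casesOn l u) (append l w) := by
  obtain ⟨v, hv, -⟩ := existsUnique_isInfCat fun i => i.casesOn l u
  obtain ⟨r, rfl, hr⟩ := hv.tail
  rwa [hw.unique hr]

theorem hasPrefix_inf_iff {l : List α} {s : ℕ → α} :
    HasPrefix l (inf s) ↔ (List.range l.length).map s = l := by
  simp only [HasPrefix, List.ext_getElem_iff, List.length_map, List.length_range, List.getElem_map,
    List.getElem_range]
  grind

theorem hasPrefix_map_range (s : ℕ → α) (n : ℕ) : HasPrefix ((List.range n).map s) (inf s) := by
  simp [hasPrefix_inf_iff]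

theorem isInfCat_inf (s : ℕ → α) : IsInfCat (fun i => [s i]) (inf s) := by
  intro l
  simp only [partialCat, ← List.map_eq_flatMap]
  exact ⟨fun hl => ⟨l.length, by rw [hasPrefix_inf_iff.1 hl]⟩,
    fun ⟨n, hn⟩ => (hasPrefix_map_range s n).of_prefix hn⟩

theorem isInfCat_nil : IsInfCat (fun _ => []) (fin ([] : List α)) := by
  simp [IsInfCat, HasPrefix, partialCat, List.flatMap_eq_nil_iff.2]

theorem exists_isInfCat (w : Trace α) : ∃ u, IsInfCat u w := by
  cases w with
  | fin w => exact ⟨_, by simpa [append] using isInfCat_nil.cons w⟩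
  | inf s => exact ⟨_, isInfCat_inf s⟩

theorem IsInfCat.exists_eq_inf {u : ℕ → List α} {w : Trace α} (hw : IsInfCat u w)
    (hu : ∃ᶠ i in atTop, u i ≠ []) : ∃ s, w = inf s := by
  have unbounded (N : ℕ) : ∃ n, N ≤ (partialCat u n).length := by
    induction N with
    | zero => exact ⟨0, Nat.zero_le _⟩
    | succ N ih =>
      obtain ⟨n, hn⟩ := ih
      obtain ⟨i, hni, hi⟩ := Filter.frequently_atTop.1 hu n
      refine ⟨i + 1, ?_⟩
      rw [partialCat_succ, List.length_append]
      exact add_le_add (hn.trans (partialCat_prefix u hni).length_le) (List.length_pos_iff.2 hi)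
  cases w with
  | fin w =>
    obtain ⟨n, hn⟩ := unbounded (w.length + 1)
    have : (partialCat u n).length ≤ w.length := List.IsPrefix.length_le (hw.hasPrefix n)
    omega
  | inf s => exact ⟨s, rfl⟩

theorem exists_isInfCat_inf {u : ℕ → List α} (hu : ∃ᶠ i in atTop, u i ≠ []) :
    ∃ s, IsInfCat u (inf s) := by
  obtain ⟨w, hw, -⟩ := existsUnique_isInfCat u
  obtain ⟨s, rfl⟩ := hw.exists_eq_inf hu
  exact ⟨s, hw⟩

section Regrouping

variable {l : ℕ → List β} {s : ℕ → β}

theorem IsInfCat.exists_map_range_prefix (hl : IsInfCat l (inf s)) (n : ℕ) :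
    ∃ m, (List.range n).map s <+: partialCat l m :=
  (hl _).1 (hasPrefix_map_range s n)

theorem IsInfCat.flatMap_iff (hl : IsInfCat l (inf s)) (φ : β → List α) {w : Trace α} :
    IsInfCat (fun i => (l i).flatMap φ) w ↔ IsInfCat (fun n => φ (s n)) w := by
  have partialCat_map (n : ℕ) :
      partialCat (fun n => φ (s n)) n = ((List.range n).map s).flatMap φ := by
    rw [partialCat, List.flatMap_map]
  have partialCat_flatMap (n : ℕ) :
      partialCat (fun i => (l i).flatMap φ) n = (partialCat l n).flatMap φ := by
    rw [partialCat, partialCat, List.flatMap_assoc]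
  refine isInfCat_congr (fun n => ⟨(partialCat l n).length, ?_⟩) fun n => ?_
  · rw [partialCat_flatMap, partialCat_map, hasPrefix_inf_iff.1 (hl.hasPrefix n)]
  · obtain ⟨m, hm⟩ := hl.exists_map_range_prefix n
    refine ⟨m, ?_⟩
    rw [partialCat_flatMap, partialCat_map]
    exact hm.flatMap φ

theorem IsInfCat.frequently (hl : IsInfCat l (inf s)) {p : β → Prop}
    (hp : ∃ᶠ i in atTop, ∃ x ∈ l i, p x) : ∃ᶠ n in atTop, p (s n) := by
  rw [Filter.frequently_atTop] at hp ⊢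
  intro N
  obtain ⟨m, hm⟩ := hl.exists_map_range_prefix N
  obtain ⟨i, hi, x, hx, hpx⟩ := hp m
  obtain ⟨j, hj, rfl⟩ := List.getElem_of_mem hx
  have hN : N ≤ (partialCat l i).length := by
    simpa using (hm.trans (partialCat_prefix l hi)).length_le
  have hlj := hl.hasPrefix (i + 1) ((partialCat l i).length + j)
    (by simpa [partialCat_succ] using hj)
  refine ⟨(partialCat l i).length + j, by omega, ?_⟩
  rw [← hlj]
  simpa [partialCat_succ] using hpx

end Regrouping

end Trace

theorem exists_strictMono_monochromatic {β : Type*} [Finite β] (c : ℕ → ℕ → β) :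
    ∃ (k : ℕ → ℕ) (b : β), StrictMono k ∧ ∀ i j, i < j → c (k i) (k j) = b := by
  have eventually_colour (φ : ℕ → β) : ∃ b, ∀ᶠ j in (Filter.hyperfilter ℕ : Filter ℕ), φ j = b := by
    have h : ∀ᶠ j in (Filter.hyperfilter ℕ : Filter ℕ), ∃ b ∈ (Set.univ : Set β), φ j = b := by
      simp
    obtain ⟨b, -, hb⟩ := (Ultrafilter.eventually_exists_mem_iff Set.finite_univ).1 h
    exact ⟨b, hb⟩
  choose d hd using fun i => eventually_colour (c i)
  obtain ⟨b, hb⟩ := eventually_colour d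
  have eventually_gt (n : ℕ) : ∀ᶠ j in (Filter.hyperfilter ℕ : Filter ℕ), n < j :=
    Filter.hyperfilter_le_cofinite (Nat.cofinite_eq_atTop ▸ Filter.eventually_gt_atTop n)
  obtain ⟨k, -, hk⟩ := exists_seq_of_forall_finset_exists (fun i => d i = b)
    (fun i j => i < j ∧ c i j = b) fun s hs =>
      (hb.and ((Filter.eventually_all_finset s).2 fun i hi => (eventually_gt i).and
        ((hd i).mono fun j hj => hj.trans (hs i hi)))).exists
  exact ⟨k, b, fun i j hij => (hk i j hij).1, fun i j hij => (hk i j hij).2⟩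

theorem exists_idempotent_factorization {M : Type*} [Monoid M] [Finite M] (c : ℕ → M) :
    ∃ (k : ℕ → ℕ) (e : M), StrictMono k ∧ k 0 = 0 ∧ e * e = e ∧
      ((List.Ico (k 0) (k 1)).map c).prod * e = ((List.Ico (k 0) (k 1)).map c).prod ∧
      ∀ i, ((List.Ico (k (i + 1)) (k (i + 2))).map c).prod = e := by
  obtain ⟨k, e, hk, he⟩ :=
    exists_strictMono_monochromatic fun a b => ((List.Ico a b).map c).prod
  have prod_Ico {a b d : ℕ} (hab : a ≤ b) (hbd : b ≤ d) :
      ((List.Ico a b).map c).prod * ((List.Ico b d).map c).prod =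
        ((List.Ico a d).map c).prod := by
    rw [← List.prod_append, ← List.map_append, List.Ico.append_consecutive hab hbd]
  have hee : e * e = e := by
    have := prod_Ico (hk zero_lt_one).le (hk one_lt_two).le
    rwa [he 0 1 zero_lt_one, he 1 2 one_lt_two, he 0 2 two_pos] at this
  refine ⟨Function.update k 0 0, e, strictMono_nat_of_lt_succ ?_, by simp, hee, ?_, fun i => ?_⟩
  · rintro (_ | i)
    · simpa using (hk zero_lt_one).pos
    · simpa using hk i.succ.lt_succ_self
  · simp only [Function.update_self, Function.update_of_ne one_ne_zero,
      ← prod_Ico (k 0).zero_le (hk zero_lt_one).le, he 0 1 zero_lt_one, mul_assoc, hee]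
  · simpa using he (i + 1) (i + 2) (Nat.lt_succ_self _)

namespace ExtBuchi

open Trace

variable {Q Ev : Type*} (𝔄 : ExtBuchi Q Ev)

theorem cls_eq_cls_iff {w u : List Ev} :
    𝔄.cls w = 𝔄.cls u ↔ (w = [] ∧ u = []) ∨ (w ≠ [] ∧ u ≠ [] ∧ 𝔄.Sim w u) :=
  Con.eq _

theorem cls_nil : 𝔄.cls [] = 1 := rfl

theorem cls_eq_one_iff {w : List Ev} : 𝔄.cls w = 1 ↔ w = [] := by
  simp [← cls_nil, cls_eq_cls_iff]

theorem cls_flatMap {ι : Type*} (l : List ι) (u : ι → List Ev) :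
    𝔄.cls (l.flatMap u) = (l.map fun i => 𝔄.cls (u i)).prod := by
  induction l with
  | nil => rfl
  | cons i l ih => rw [List.flatMap_cons, cls_append, ih, List.map_cons, List.prod_cons]

instance finite_cls [Finite Q] : Finite 𝔄.Cls := by
  choose rep cls_rep using 𝔄.words_nonempty
  refine Finite.of_injective (β := Prop × (Q → Q → Prop) × (Q → Q → Prop))
    (fun C => (rep C = [], fun p q => 𝔄.Reach p (rep C) q, fun p q => 𝔄.ReachF p (rep C) q))
    fun C D h => ?_
  simp only [Prod.mk.injEq, funext_iff, eq_iff_iff] at h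
  obtain ⟨hnil, hReach, hReachF⟩ := h
  rw [← cls_rep C, ← cls_rep D, cls_eq_cls_iff]
  by_cases hC : rep C = []
  · exact .inl ⟨hC, hnil.1 hC⟩
  · exact .inr ⟨hC, mt hnil.2 hC, fun p q => ⟨hReach p q, hReachF p q⟩⟩

theorem mem_lasso_iff {p : 𝔄.LPair} {w : Trace Ev} :
    w ∈ 𝔄.lasso p ↔ ∃ u, IsInfCat u w ∧ 𝔄.cls (u 0) = p.1.1 ∧ ∀ i, 𝔄.cls (u (i + 1)) = p.1.2 := by
  constructor
  · rintro ⟨c, hc, t, ⟨d, hd, ht⟩, rfl⟩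
    exact ⟨_, ht.cons c, hc, hd⟩
  · rintro ⟨u, hu, hc, hd⟩
    obtain ⟨t, rfl, ht⟩ := hu.tail
    exact ⟨u 0, hc, t, ⟨_, hd, ht⟩, rfl⟩

theorem exists_lasso [Finite Q] (c : ℕ → 𝔄.Cls) :
    ∃ p : 𝔄.LPair, ∀ u w, (∀ i, 𝔄.cls (u i) = c i) → IsInfCat u w → w ∈ 𝔄.lasso p := by
  obtain ⟨k, e, hk, hk₀, he, hprefix, hperiod⟩ := exists_idempotent_factorization c
  refine ⟨⟨(((List.Ico (k 0) (k 1)).map c).prod, e), hprefix, he⟩, fun u w hu hw => ?_⟩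
  exact 𝔄.mem_lasso_iff.2 ⟨_, (isInfCat_group hk hk₀).2 hw, by simp only [cls_flatMap, hu],
    fun i => by simp only [cls_flatMap, hu, hperiod]⟩

theorem exists_mem_lasso [Finite Q] (w : Trace Ev) : ∃ p : 𝔄.LPair, w ∈ 𝔄.lasso p := by
  obtain ⟨u, hu⟩ := exists_isInfCat w
  exact (𝔄.exists_lasso fun i => 𝔄.cls (u i)).imp fun p hp => hp u w (fun _ => rfl) hu

end ExtBuchi

theorem append_mem_kstar {α : Type*} {U : Language α} {u w : List α} (hu : u ∈ U) (hw : w ∈ U∗) :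
    u ++ w ∈ U∗ := by
  rw [← Language.one_add_self_mul_kstar_eq_kstar]
  exact .inr (Language.append_mem_mul hu hw)

namespace ExtBuchi

open Trace

variable {Q Ev : Type*} (𝔄 : ExtBuchi Q Ev)

theorem mem_of_mem_lasso {𝔄 : ExtBuchi Q Ev} {𝒱 : 𝔄.MOmega} {p q : 𝔄.LPair} {w : Trace Ev}
    (hq : q ∈ 𝒱.1) (hwp : w ∈ 𝔄.lasso p) (hwq : w ∈ 𝔄.lasso q) : p ∈ 𝒱.1 :=
  𝔄.mem_MOmega_iff.1 𝒱.2 p q hq ⟨w, hwp, hwq⟩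

theorem alphaOmega_subset_iff {V : Set (Trace Ev)} {𝒱 : 𝔄.MOmega} :
    (𝔄.alphaOmega V).1 ⊆ 𝒱.1 ↔ 𝔄.preAbs V ⊆ 𝒱.1 := by
  refine ⟨fun h p hp => h <| Set.mem_iUnion.2 ⟨0, 𝔄.mem_preAbs_preConc.2 ⟨p, hp, ?_⟩⟩,
    fun h => Set.iUnion_subset fun n => ?_⟩
  · simpa using 𝔄.lasso_nonempty p
  · suffices ∀ n, (fun 𝒲 => 𝔄.preAbs (𝔄.preConc 𝒲))^[n] (𝔄.preAbs V) ⊆ 𝒱.1 from this (n + 1)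
    intro n
    induction n with
    | zero => exact h
    | succ n ih =>
      rw [Function.iterate_succ_apply']
      intro p hp
      obtain ⟨q, hq, w, hwp, hwq⟩ := 𝔄.mem_preAbs_preConc.1 hp
      exact mem_of_mem_lasso (ih hq) hwp hwq

theorem mem_alphaOmega {V : Set (Trace Ev)} {p : 𝔄.LPair} {w : Trace Ev} (hp : w ∈ 𝔄.lasso p)
    (hw : w ∈ V) : p ∈ (𝔄.alphaOmega V).1 :=
  𝔄.alphaOmega_subset_iff.1 Set.Subset.rfl ⟨w, hp, hw⟩

theorem alphaOmega_subset_of_forall_exists {V : Set (Trace Ev)} {𝒱 : 𝔄.MOmega}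
    (h : ∀ v ∈ V, ∃ p ∈ 𝒱.1, v ∈ 𝔄.lasso p) : (𝔄.alphaOmega V).1 ⊆ 𝒱.1 := by
  refine 𝔄.alphaOmega_subset_iff.2 ?_
  rintro p ⟨v, hp, hv⟩
  obtain ⟨q, hq, hvq⟩ := h v hv
  exact mem_of_mem_lasso hq hp hvq

theorem alphaOmega_mono {V W : Set (Trace Ev)} (h : V ⊆ W) :
    (𝔄.alphaOmega V).1 ⊆ (𝔄.alphaOmega W).1 :=
  𝔄.alphaOmega_subset_iff.2 fun _ ⟨_, hp, hv⟩ => 𝔄.mem_alphaOmega hp (h hv)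

theorem alphaOmega_empty : 𝔄.alphaOmega ∅ = 𝔄.omegaEmpty :=
  Subtype.ext <| Set.subset_empty_iff.1 <|
    𝔄.alphaOmega_subset_iff (𝒱 := 𝔄.omegaEmpty).2 fun _ ⟨_, _, hv⟩ => hv.elim

theorem alphaOmega_union (V W : Set (Trace Ev)) :
    𝔄.alphaOmega (V ∪ W) = 𝔄.omegaUnion (𝔄.alphaOmega V) (𝔄.alphaOmega W) := by
  refine Subtype.ext (Set.Subset.antisymm (𝔄.alphaOmega_subset_iff.2 ?_) (Set.union_subset
    (𝔄.alphaOmega_mono Set.subset_union_left) (𝔄.alphaOmega_mono Set.subset_union_right)))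
  rintro p ⟨v, hp, hv | hv⟩
  · exact .inl (𝔄.mem_alphaOmega hp hv)
  · exact .inr (𝔄.mem_alphaOmega hp hv)

/-- The pair `(AC, D)` for `p = (C, D)`, so that `catPairs 𝒰 𝒱` is the image of `𝒰 × 𝒱` under
`mulPair`. -/
def mulPair (A : 𝔄.Cls) (p : 𝔄.LPair) : 𝔄.LPair :=
  ⟨(A * p.1.1, p.1.2), by rw [mul_assoc, p.2.1], p.2.2⟩

theorem append_mem_lasso_mulPair (a : List Ev) {w : Trace Ev} {p : 𝔄.LPair}
    (hw : w ∈ 𝔄.lasso p) : append a w ∈ 𝔄.lasso (𝔄.mulPair (𝔄.cls a) p) := by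
  obtain ⟨c, hc, t, ht, rfl⟩ := hw
  exact ⟨a ++ c, congrArg (𝔄.cls a * ·) hc, t, ht, (append_append a c t).symm⟩

theorem mem_alphaStar {U : Set (List Ev)} {C : 𝔄.Cls} :
    C ∈ 𝔄.alphaStar U ↔ ∃ w ∈ U, 𝔄.cls w = C :=
  exists_congr fun _ => and_comm

theorem mem_gammaStar_alphaStar {U : Set (List Ev)} {w : List Ev} :
    w ∈ 𝔄.gammaStar (𝔄.alphaStar U) ↔ ∃ u ∈ U, 𝔄.cls u = 𝔄.cls w := by
  simp [gammaStar, words, mem_alphaStar, eq_comm]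

theorem alphaOmega_catSet [Finite Q] (U : Set (List Ev)) (V : Set (Trace Ev)) :
    𝔄.alphaOmega (catSet U V) = 𝔄.omegaCat (𝔄.alphaStar U) (𝔄.alphaOmega V) := by
  refine Subtype.ext (Set.Subset.antisymm ?_ ?_)
  · refine 𝔄.alphaOmega_subset_of_forall_exists ?_
    rintro _ ⟨a, ha, v, hv, rfl⟩
    obtain ⟨q, hq⟩ := 𝔄.exists_mem_lasso v
    exact ⟨𝔄.mulPair (𝔄.cls a) q, ⟨𝔄.cls a, 𝔄.mem_alphaStar.2 ⟨a, ha, rfl⟩, q,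
      𝔄.mem_alphaOmega hq hv, rfl, rfl⟩, 𝔄.append_mem_lasso_mulPair a hq⟩
  · rintro p ⟨A, hA, q, hq, h₁, h₂⟩
    obtain rfl : p = 𝔄.mulPair A q := Subtype.ext (Prod.ext h₁ h₂)
    obtain ⟨a, ha, rfl⟩ := 𝔄.mem_alphaStar.1 hA
    let 𝒲 : 𝔄.MOmega := ⟨{r | 𝔄.mulPair (𝔄.cls a) r ∈ (𝔄.alphaOmega (catSet U V)).1},
      𝔄.mem_MOmega_iff.2 fun _ _ hr ⟨_, hw, hw'⟩ =>
        mem_of_mem_lasso (𝒱 := 𝔄.alphaOmega (catSet U V)) hr (𝔄.append_mem_lasso_mulPair a hw)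
          (𝔄.append_mem_lasso_mulPair a hw')⟩
    refine 𝔄.alphaOmega_subset_iff (𝒱 := 𝒲).2 ?_ hq
    rintro r ⟨v, hr, hv⟩
    exact 𝔄.mem_alphaOmega (𝔄.append_mem_lasso_mulPair a hr) ⟨a, ha, v, hv, rfl⟩

theorem alphaOmega_omegaPow [Finite Q] (U : Set (List Ev)) :
    𝔄.alphaOmega (omegaPow U) = 𝔄.omegaIter (𝔄.alphaStar U) := by
  refine Subtype.ext (Set.Subset.antisymm (𝔄.alphaOmega_mono ?_) ?_)
  · rintro w ⟨u, hu, hw⟩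
    exact ⟨u, fun i => 𝔄.mem_gammaStar_alphaStar.2 ⟨_, hu i, rfl⟩, hw⟩
  · refine 𝔄.alphaOmega_subset_of_forall_exists ?_
    rintro w ⟨v, hv, hw⟩
    choose u hu huv using fun i => 𝔄.mem_gammaStar_alphaStar.1 (hv i)
    obtain ⟨z, hz, -⟩ := existsUnique_isInfCat u
    obtain ⟨p, hp⟩ := 𝔄.exists_lasso fun i => 𝔄.cls (v i)
    exact ⟨p, 𝔄.mem_alphaOmega (hp u z huv hz) ⟨u, hu, hz⟩, hp v w (fun _ => rfl) hw⟩

theorem alphaStar_zero : 𝔄.alphaStar (0 : Language Ev) = ∅ :=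
  Set.eq_empty_of_forall_notMem fun _ ⟨_, _, hw⟩ => hw.elim

theorem alphaStar_one : 𝔄.alphaStar (1 : Language Ev) = {1} := by
  ext C
  simp [mem_alphaStar, ← cls_nil, Language.one_def, eq_comm]

theorem alphaStar_add (U V : Language Ev) :
    𝔄.alphaStar (U + V) = 𝔄.alphaStar U ∪ 𝔄.alphaStar V := by
  ext C
  constructor
  · rintro ⟨w, hw, hU | hV⟩
    · exact .inl ⟨w, hw, hU⟩
    · exact .inr ⟨w, hw, hV⟩
  · rintro (⟨w, hw, hU⟩ | ⟨w, hw, hV⟩)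
    · exact ⟨w, hw, .inl hU⟩
    · exact ⟨w, hw, .inr hV⟩

theorem alphaStar_mul (U V : Language Ev) :
    𝔄.alphaStar (U * V) = 𝔄.starCat (𝔄.alphaStar U) (𝔄.alphaStar V) := by
  ext C
  constructor
  · rintro ⟨_, hC, a, ha, b, hb, rfl⟩
    exact ⟨_, ⟨a, rfl, ha⟩, _, ⟨b, rfl, hb⟩, hC.symm.trans (𝔄.cls_append a b)⟩
  · rintro ⟨A, ⟨a, hA, ha⟩, B, ⟨b, hB, hb⟩, rfl⟩
    exact ⟨a ++ b, congrArg₂ (· * ·) hA hB, a, ha, b, hb, rfl⟩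

theorem alphaStar_kstar (U : Language Ev) :
    𝔄.alphaStar (U∗ : Language Ev) = 𝔄.starIter (𝔄.alphaStar U) := by
  ext C
  refine 𝔄.mem_alphaStar.trans ⟨?_, fun hC => ?_⟩
  · rintro ⟨_, ⟨l, rfl, hl⟩, rfl⟩
    rw [← List.flatMap_id, cls_flatMap]
    refine Submonoid.list_prod_mem _ fun C hC => Submonoid.subset_closure ?_
    obtain ⟨u, hu, rfl⟩ := List.mem_map.1 hC
    exact 𝔄.mem_alphaStar.2 ⟨u, hl u hu, rfl⟩
  · refine Submonoid.closure_induction_left (motive := fun C _ => ∃ w ∈ U∗, 𝔄.cls w = C)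
      ⟨[], Language.nil_mem_kstar U, rfl⟩ ?_ hC
    rintro A hA _ - ⟨w, hw, rfl⟩
    obtain ⟨u, hu, rfl⟩ := 𝔄.mem_alphaStar.1 hA
    exact ⟨u ++ w, append_mem_kstar hu hw, 𝔄.cls_append u w⟩

end ExtBuchi

theorem Trace.IsInfCat.eq_map_Ico {α : Type*} {u : ℕ → List α} {s : ℕ → α}
    (hu : IsInfCat u (inf s)) (i : ℕ) :
    u i = (List.Ico (partialCat u i).length (partialCat u (i + 1)).length).map s := by
  have eq_map (n : ℕ) : (List.Ico 0 (partialCat u n).length).map s = partialCat u n := by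
    rw [List.Ico.zero_bot]
    exact hasPrefix_inf_iff.1 (hu.hasPrefix n)
  refine List.append_cancel_left (as := partialCat u i) ?_
  calc partialCat u i ++ u i = partialCat u (i + 1) := (partialCat_succ u i).symm
    _ = (List.Ico 0 (partialCat u i).length ++ _).map s := by
      rw [List.Ico.append_consecutive (Nat.zero_le _) (partialCat_prefix u i.le_succ).length_le,
        eq_map]
    _ = _ := by rw [List.map_append, eq_map]

namespace ExtBuchi

open Trace
open Filter (atTop)

variable {Q Ev : Type*} (𝔄 : ExtBuchi Q Ev)

theorem reach_map_Ico {ρ : ℕ → Q} {s : ℕ → Ev} (hρ : ∀ n, ρ (n + 1) ∈ 𝔄.δ (ρ n) (s n)) {a b : ℕ}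
    (hab : a ≤ b) : 𝔄.Reach (ρ a) ((List.Ico a b).map s) (ρ b) := by
  induction b, hab using Nat.le_induction with
  | base => simp [Reach]
  | succ b hab ih =>
    rw [List.Ico.succ_top hab, List.map_append, reach_append]
    exact ⟨ρ b, ih, ρ (b + 1), hρ b, rfl⟩

theorem reachF_map_Ico {ρ : ℕ → Q} {s : ℕ → Ev} (hρ : ∀ n, ρ (n + 1) ∈ 𝔄.δ (ρ n) (s n))
    {a m b : ℕ} (ham : a ≤ m) (hmb : m ≤ b) (hm : ρ m ∈ 𝔄.F) :
    𝔄.ReachF (ρ a) ((List.Ico a b).map s) (ρ b) :=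
  ⟨ρ m, hm, _, _, by rw [← List.map_append, List.Ico.append_consecutive ham hmb],
    𝔄.reach_map_Ico hρ ham, 𝔄.reach_map_Ico hρ hmb⟩

theorem exists_reach_of_accepts {u : ℕ → List Ev} {s : ℕ → Ev} (hu : IsInfCat u (inf s))
    (h : 𝔄.Accepts (inf s)) :
    ∃ p : ℕ → Q, p 0 = 𝔄.q₀ ∧ (∀ i, 𝔄.Reach (p i) (u i) (p (i + 1))) ∧
      ∃ᶠ i in atTop, 𝔄.ReachF (p i) (u i) (p (i + 1)) := by
  obtain ⟨ρ, hρ₀, hρ, hF⟩ := h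
  set k : ℕ → ℕ := fun i => (partialCat u i).length
  have k_mono : Monotone k := fun _ _ hij => (partialCat_prefix u hij).length_le
  refine ⟨ρ ∘ k, hρ₀, fun i => ?_, Filter.frequently_atTop.2 fun n => ?_⟩
  · rw [hu.eq_map_Ico i]
    exact 𝔄.reach_map_Ico hρ (k_mono i.le_succ)
  · obtain ⟨m, hnm, hm⟩ := hF (k n)
    obtain ⟨M, hM⟩ : ∃ M, m < k M :=
      (hu.exists_map_range_prefix (m + 1)).imp fun M hM => by simpa using hM.length_le
    obtain ⟨i, -, hi⟩ := Set.mem_iUnion₂.1 <| Ico_subset_biUnion_Ico M (fun j => k (n + j))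
      ⟨hnm, hM.trans_le (k_mono (Nat.le_add_left M n))⟩
    refine ⟨n + i, Nat.le_add_right n i, ?_⟩
    rw [hu.eq_map_Ico (n + i)]
    exact 𝔄.reachF_map_Ico hρ hi.1 hi.2.le hm

/-- The automaton `𝔄` reading, together with each event, the state in which `𝔄` reads it. A word
over `Q × Ev` determines the run on it, so runs of `𝔄` are concatenated by concatenating words. -/
def tracing : ExtBuchi Q (Q × Ev) where
  δ p x := {r | x.1 = p ∧ r ∈ 𝔄.δ p x.2}
  q₀ := 𝔄.q₀
  F := 𝔄.F

theorem exists_tracing_reach {p q : Q} {w : List Ev} (h : 𝔄.Reach p w q) :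
    ∃ l, l.map Prod.snd = w ∧ 𝔄.tracing.Reach p l q := by
  induction w generalizing p with
  | nil => exact ⟨[], rfl, h⟩
  | cons a w ih =>
    obtain ⟨r, hr, h⟩ := h
    obtain ⟨l, rfl, hl⟩ := ih h
    exact ⟨(p, a) :: l, rfl, r, ⟨rfl, hr⟩, hl⟩

theorem exists_tracing_reach_of_reachF {p q : Q} {w : List Ev} (h : 𝔄.ReachF p w q) :
    ∃ l, l.map Prod.snd = w ∧ 𝔄.tracing.Reach p l q ∧ ((∃ x ∈ l, x.1 ∈ 𝔄.F) ∨ q ∈ 𝔄.F) := by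
  obtain ⟨r, hr, u, v, rfl, hu, hv⟩ := h
  obtain ⟨l, rfl, hl⟩ := 𝔄.exists_tracing_reach hu
  obtain ⟨l', rfl, hl'⟩ := 𝔄.exists_tracing_reach hv
  refine ⟨l ++ l', List.map_append, 𝔄.tracing.reach_append.2 ⟨r, hl, hl'⟩, ?_⟩
  cases l' with
  | nil => exact .inr (hl' ▸ hr)
  | cons x l' =>
    obtain ⟨_, ⟨rfl, -⟩, -⟩ := hl'
    exact .inl ⟨x, by simp, hr⟩

theorem exists_tracing_reach_of_reach {p q : Q} {w : List Ev} (h : 𝔄.Reach p w q) :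
    ∃ l, l.map Prod.snd = w ∧ 𝔄.tracing.Reach p l q ∧
      (𝔄.ReachF p w q → (∃ x ∈ l, x.1 ∈ 𝔄.F) ∨ q ∈ 𝔄.F) := by
  by_cases hF : 𝔄.ReachF p w q
  · obtain ⟨l, hl, hr, hv⟩ := 𝔄.exists_tracing_reach_of_reachF hF
    exact ⟨l, hl, hr, fun _ => hv⟩
  · obtain ⟨l, hl, hr⟩ := 𝔄.exists_tracing_reach h
    exact ⟨l, hl, hr, fun h' => absurd h' hF⟩

theorem accepts_of_tracing_reach {σ : ℕ → Q × Ev}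
    (hσ : ∀ n, ∃ q, 𝔄.tracing.Reach 𝔄.q₀ ((List.range n).map σ) q)
    (hF : ∃ᶠ n in atTop, (σ n).1 ∈ 𝔄.F) : 𝔄.Accepts (inf fun n => (σ n).2) := by
  refine ⟨fun n => (σ n).1, ?_, fun n => ?_, Filter.frequently_atTop.1 hF⟩
  · obtain ⟨q, r, ⟨h, -⟩, -⟩ := hσ 1
    exact h
  · obtain ⟨q, hq⟩ := hσ (n + 2)
    rw [List.range_succ, List.range_succ, List.append_assoc, List.map_append, reach_append] at hq
    obtain ⟨p, -, r, ⟨rfl, hr⟩, _, ⟨rfl, -⟩, -⟩ := hq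
    exact hr

theorem accepts_of_reach {u : ℕ → List Ev} {s : ℕ → Ev} (hu : IsInfCat u (inf s))
    (hne : ∀ i, u i ≠ []) {p : ℕ → Q} (hp₀ : p 0 = 𝔄.q₀)
    (hp : ∀ i, 𝔄.Reach (p i) (u i) (p (i + 1)))
    (hF : ∃ᶠ i in atTop, 𝔄.ReachF (p i) (u i) (p (i + 1))) : 𝔄.Accepts (inf s) := by
  choose l hl hr hv using fun i => 𝔄.exists_tracing_reach_of_reach (hp i)
  have l_ne (i : ℕ) : l i ≠ [] := fun h => hne i (by rw [← hl i, h, List.map_nil])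
  obtain ⟨σ, hσ⟩ := exists_isInfCat_inf (Filter.Frequently.of_forall (f := atTop) l_ne)
  obtain rfl : u = fun i => (l i).flatMap fun x => [x.2] :=
    funext fun i => by rw [← List.map_eq_flatMap]; exact (hl i).symm
  have s_eq : inf s = inf fun n => (σ n).2 :=
    hu.unique ((hσ.flatMap_iff fun x => [x.2]).2 (isInfCat_inf _))
  have reach_partialCat (n : ℕ) : 𝔄.tracing.Reach 𝔄.q₀ (partialCat l n) (p n) := by
    induction n with
    | zero => exact hp₀.symm
    | succ n ih =>
      rw [partialCat_succ, reach_append]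
      exact ⟨p n, ih, hr n⟩
  have visit_next (i : ℕ) (hi : p i ∈ 𝔄.F) : ∃ x ∈ l i, x.1 ∈ 𝔄.F := by
    obtain ⟨x, t, hx⟩ := List.exists_cons_of_ne_nil (l_ne i)
    obtain ⟨_, ⟨hxp, -⟩, -⟩ := hx ▸ hr i
    exact ⟨x, by simp [hx], hxp ▸ hi⟩
  rw [s_eq]
  refine 𝔄.accepts_of_tracing_reach (fun n => ?_) (hσ.frequently (p := fun x => x.1 ∈ 𝔄.F) ?_)
  · obtain ⟨m, t, ht⟩ := hσ.exists_map_range_prefix n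
    obtain ⟨q, hq, -⟩ := 𝔄.tracing.reach_append.1 (ht ▸ reach_partialCat m)
    exact ⟨q, hq⟩
  · rcases Filter.frequently_or_distrib.1 (hF.mono fun i => hv i) with h | h
    · exact h
    · exact (Filter.tendsto_add_atTop_nat 1).frequently (h.mono fun i => visit_next (i + 1))

theorem accepts_iff_of_isInfCat {u : ℕ → List Ev} {w : Trace Ev} (hu : IsInfCat u w)
    (hne : ∀ i, u i ≠ []) :
    𝔄.Accepts w ↔ ∃ p : ℕ → Q, p 0 = 𝔄.q₀ ∧ (∀ i, 𝔄.Reach (p i) (u i) (p (i + 1))) ∧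
      ∃ᶠ i in atTop, 𝔄.ReachF (p i) (u i) (p (i + 1)) := by
  obtain ⟨s, rfl⟩ := hu.exists_eq_inf (Filter.Frequently.of_forall hne)
  exact ⟨𝔄.exists_reach_of_accepts hu, fun ⟨p, hp₀, hp, hF⟩ => 𝔄.accepts_of_reach hu hne hp₀ hp hF⟩

theorem sim_of_cls_eq {w u : List Ev} (h : 𝔄.cls w = 𝔄.cls u) : 𝔄.Sim w u := by
  rcases 𝔄.cls_eq_cls_iff.1 h with ⟨rfl, rfl⟩ | ⟨-, -, h⟩
  · exact fun _ _ => ⟨Iff.rfl, Iff.rfl⟩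
  · exact h

theorem accepts_fin_congr {w u : List Ev} (h : 𝔄.cls w = 𝔄.cls u) :
    𝔄.Accepts (fin w) ↔ 𝔄.Accepts (fin u) := by
  simp only [Accepts, (𝔄.sim_of_cls_eq h _ _).1]

theorem accepts_congr_of_isInfCat {u v : ℕ → List Ev} {w z : Trace Ev} (hw : IsInfCat u w)
    (hz : IsInfCat v z) (hne : ∀ i, u i ≠ []) (h : ∀ i, 𝔄.cls (u i) = 𝔄.cls (v i)) :
    𝔄.Accepts w ↔ 𝔄.Accepts z := by
  have hne' (i : ℕ) : v i ≠ [] := by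
    rw [Ne, ← 𝔄.cls_eq_one_iff, ← h i, 𝔄.cls_eq_one_iff]
    exact hne i
  rw [𝔄.accepts_iff_of_isInfCat hw hne, 𝔄.accepts_iff_of_isInfCat hz hne']
  simp only [(𝔄.sim_of_cls_eq (h _) _ _).1, (𝔄.sim_of_cls_eq (h _) _ _).2]

theorem exists_eq_fin_of_mem_lasso {p : 𝔄.LPair} (hp : p.1.2 = 1) {w : Trace Ev}
    (hw : w ∈ 𝔄.lasso p) : ∃ c, 𝔄.cls c = p.1.1 ∧ w = fin c := by
  obtain ⟨c, hc, t, ⟨d, hd, ht⟩, rfl⟩ := hw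
  obtain rfl : d = fun _ => [] := funext fun i => 𝔄.cls_eq_one_iff.1 ((hd i).trans hp)
  exact ⟨c, hc, by rw [ht.unique isInfCat_nil, append, List.append_nil]⟩

theorem accepts_congr_of_mem_lasso {p : 𝔄.LPair} {w z : Trace Ev} (hw : w ∈ 𝔄.lasso p)
    (hz : z ∈ 𝔄.lasso p) : 𝔄.Accepts w ↔ 𝔄.Accepts z := by
  by_cases hp : p.1.2 = 1
  · obtain ⟨c, hc, rfl⟩ := 𝔄.exists_eq_fin_of_mem_lasso hp hw
    obtain ⟨d, hd, rfl⟩ := 𝔄.exists_eq_fin_of_mem_lasso hp hz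
    exact 𝔄.accepts_fin_congr (hc.trans hd.symm)
  · obtain ⟨u, hu, hu₀, hu'⟩ := 𝔄.mem_lasso_iff.1 hw
    obtain ⟨v, hv, hv₀, hv'⟩ := 𝔄.mem_lasso_iff.1 hz
    have p_ne_one : p.1.1 ≠ 1 := fun h => hp (by simpa [h] using p.2.1)
    refine 𝔄.accepts_congr_of_isInfCat hu hv ?_ ?_
    · rintro (_ | i) <;> rw [Ne, ← 𝔄.cls_eq_one_iff]
      · rwa [hu₀]
      · rwa [hu']
    · rintro (_ | i)
      · rw [hu₀, hv₀]
      · rw [hu', hv']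

theorem gammaStar_alphaStar_subset_lang_iff (U : Set (List Ev)) :
    fin '' 𝔄.gammaStar (𝔄.alphaStar U) ⊆ 𝔄.lang ↔ fin '' U ⊆ 𝔄.lang := by
  simp only [Set.image_subset_iff]
  refine ⟨fun h u hu => h (𝔄.mem_gammaStar_alphaStar.2 ⟨u, hu, rfl⟩), fun h w hw => ?_⟩
  obtain ⟨u, hu, huw⟩ := 𝔄.mem_gammaStar_alphaStar.1 hw
  exact (𝔄.accepts_fin_congr huw).1 (h hu)

theorem gammaOmega_alphaOmega_subset_lang_iff [Finite Q] (V : Set (Trace Ev)) :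
    𝔄.gammaOmega (𝔄.alphaOmega V) ⊆ 𝔄.lang ↔ V ⊆ 𝔄.lang := by
  refine ⟨fun h v hv => ?_, fun h => ?_⟩
  · obtain ⟨p, hp⟩ := 𝔄.exists_mem_lasso v
    exact h (Set.mem_biUnion (𝔄.mem_alphaOmega hp hv) hp)
  · let 𝒲 : 𝔄.MOmega := ⟨{p | 𝔄.lasso p ⊆ 𝔄.lang}, 𝔄.mem_MOmega_iff.2
      fun _ _ hq ⟨_, hwp, hwq⟩ _ hz => (𝔄.accepts_congr_of_mem_lasso hwp hz).1 (hq hwq)⟩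
    refine Set.iUnion₂_subset (𝔄.alphaOmega_subset_iff (𝒱 := 𝒲).2 ?_)
    rintro p ⟨v, hvp, hv⟩ z hz
    exact (𝔄.accepts_congr_of_mem_lasso hvp hz).1 (h hv)

end ExtBuchi

section Semantics

open Trace
open Filter (atTop)

variable {Ev Proc : Type*} {P : Program Ev Proc} {e e₁ e₂ : Expr Ev Proc} {f : Proc}

theorem terminates_call_iff {w : List (Option Ev)} :
    Terminates P (.call f) w ↔ ∃ v, w = none :: v ∧ Terminates P (P f) v :=
  ⟨fun | .call h => ⟨_, rfl, h⟩, fun ⟨_, hw, h⟩ => hw ▸ .call h⟩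

theorem terminates_seq_iff {w : List (Option Ev)} :
    Terminates P (.seq e₁ e₂) w ↔ ∃ u v, w = u ++ v ∧ Terminates P e₁ u ∧ Terminates P e₂ v :=
  ⟨fun | .seq h₁ h₂ => ⟨_, _, rfl, h₁, h₂⟩, fun ⟨_, _, hw, h₁, h₂⟩ => hw ▸ .seq h₁ h₂⟩

theorem terminates_choice_iff {w : List (Option Ev)} :
    Terminates P (.choice e₁ e₂) w ↔ Terminates P e₁ w ∨ Terminates P e₂ w :=
  ⟨fun | .choice_left h => .inl h
       | .choice_right h => .inr h,
    fun h => h.elim .choice_left .choice_right⟩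

theorem observes_out_iff {a : Ev} {w : List (Option Ev)} :
    Observes P (.out a) w ↔ w = [] ∨ w = [some a] :=
  ⟨fun | .out _ => .inr rfl
       | .nil _ => .inl rfl,
    fun h => h.elim (· ▸ .nil _) (· ▸ .out a)⟩

theorem observes_call_iff {w : List (Option Ev)} :
    Observes P (.call f) w ↔ w = [] ∨ ∃ v, w = none :: v ∧ Observes P (P f) v :=
  ⟨fun | .call h => .inr ⟨_, rfl, h⟩
       | .nil _ => .inl rfl,
    fun h => h.elim (· ▸ .nil _) fun ⟨_, hw, h⟩ => hw ▸ .call h⟩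

theorem observes_seq_iff {w : List (Option Ev)} :
    Observes P (.seq e₁ e₂) w ↔
      Observes P e₁ w ∨ ∃ u v, w = u ++ v ∧ Terminates P e₁ u ∧ Observes P e₂ v :=
  ⟨fun | .seq_left h => .inl h
       | .seq_right h₁ h₂ => .inr ⟨_, _, rfl, h₁, h₂⟩
       | .nil _ => .inl (.nil _),
    fun h => h.elim .seq_left fun ⟨_, _, hw, h₁, h₂⟩ => hw ▸ .seq_right h₁ h₂⟩

theorem observes_choice_iff {w : List (Option Ev)} :
    Observes P (.choice e₁ e₂) w ↔ Observes P e₁ w ∨ Observes P e₂ w :=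
  ⟨fun | .choice_left h => .inl h
       | .choice_right h => .inr h
       | .nil _ => .inl (.nil _),
    fun h => h.elim .choice_left .choice_right⟩

theorem prefix_append_cases {α : Type*} {u a b : List α} (h : u <+: a ++ b) :
    u <+: a ∨ ∃ c, u = a ++ c ∧ c <+: b := by
  rcases le_total u.length a.length with hl | hl
  · exact .inl (List.prefix_of_prefix_length_le h (List.prefix_append a b) hl)
  · obtain ⟨c, rfl⟩ := List.prefix_of_prefix_length_le (List.prefix_append a b) h hl
    exact .inr ⟨c, rfl, (List.prefix_append_right_inj a).1 h⟩

theorem Terminates.observes_prefix {u v : List (Option Ev)} (h : Terminates P e u)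
    (hvu : v <+: u) : Observes P e v := by
  induction h generalizing v with
  | out a =>
    rcases List.prefix_cons_iff.1 hvu with rfl | ⟨t, rfl, ht⟩
    · exact .nil _
    · exact List.prefix_nil.1 ht ▸ .out a
  | call _ ih =>
    rcases List.prefix_cons_iff.1 hvu with rfl | ⟨t, rfl, ht⟩
    · exact .nil _
    · exact .call (ih ht)
  | seq h₁ _ ih₁ ih₂ =>
    rcases prefix_append_cases hvu with hv | ⟨c, rfl, hc⟩
    · exact .seq_left (ih₁ hv)
    · exact .seq_right h₁ (ih₂ hc)
  | choice_left _ ih => exact .choice_left (ih hvu)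
  | choice_right _ ih => exact .choice_right (ih hvu)

theorem Observes.mono {u v : List (Option Ev)} (h : Observes P e u) (hvu : v <+: u) :
    Observes P e v := by
  induction h generalizing v with
  | out a => exact (Terminates.out a).observes_prefix hvu
  | nil e => exact List.prefix_nil.1 hvu ▸ .nil e
  | call _ ih =>
    rcases List.prefix_cons_iff.1 hvu with rfl | ⟨t, rfl, ht⟩
    · exact .nil _
    · exact .call (ih ht)
  | seq_right h₁ _ ih₂ =>
    rcases prefix_append_cases hvu with hv | ⟨c, rfl, hc⟩
    · exact .seq_left (h₁.observes_prefix hv)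
    · exact .seq_right h₁ (ih₂ hc)
  | seq_left _ ih => exact .seq_left (ih hvu)
  | choice_left _ ih => exact .choice_left (ih hvu)
  | choice_right _ ih => exact .choice_right (ih hvu)

variable (P) in
/-- `e ⇑ u` for every finite prefix `u` of the infinite extended word `s`. -/
def ObservesInf (e : Expr Ev Proc) (s : ℕ → Option Ev) : Prop :=
  ∀ n, Observes P e ((List.range n).map s)

theorem map_range_prefix {α : Type*} (s : ℕ → α) {m n : ℕ} (h : m ≤ n) :
    (List.range m).map s <+: (List.range n).map s := by
  obtain ⟨k, rfl⟩ := Nat.exists_eq_add_of_le h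
  rw [List.range_add, List.map_append]
  exact List.prefix_append _ _

theorem map_range_eq_append {α : Type*} {s : ℕ → α} {n : ℕ} {u v : List α}
    (h : (List.range n).map s = u ++ v) :
    u = (List.range u.length).map s ∧ v = (List.range v.length).map fun i => s (u.length + i) := by
  obtain rfl : n = u.length + v.length := by simpa using congrArg List.length h
  rw [List.range_add, List.map_append, List.map_map] at h
  obtain ⟨hu, hv⟩ := List.append_inj h (by simp)
  exact ⟨hu.symm, hv.symm⟩

theorem observesInf_of_frequently {s : ℕ → Option Ev}
    (h : ∃ᶠ n in atTop, Observes P e ((List.range n).map s)) : ObservesInf P e s := fun n =>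
  let ⟨_, hnm, hm⟩ := Filter.frequently_atTop.1 h n
  hm.mono (map_range_prefix s hnm)

theorem not_observesInf_out {a : Ev} {s : ℕ → Option Ev} : ¬ ObservesInf P (.out a) s := fun h => by
  simpa [List.range_succ] using observes_out_iff.1 (h 2)

theorem ObservesInf.call {s : ℕ → Option Ev} (h : ObservesInf P (.call f) s) :
    s 0 = none ∧ ObservesInf P (P f) fun i => s (i + 1) := by
  have tail (n : ℕ) : s 0 = none ∧ Observes P (P f) ((List.range n).map fun i => s (i + 1)) := by
    have := observes_call_iff.1 (h (n + 1))
    rw [List.range_succ_eq_map, List.map_cons, List.map_map] at this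
    simpa [Function.comp_def] using this
  exact ⟨(tail 0).1, fun n => (tail n).2⟩

theorem ObservesInf.choice {s : ℕ → Option Ev} (h : ObservesInf P (.choice e₁ e₂) s) :
    ObservesInf P e₁ s ∨ ObservesInf P e₂ s :=
  (Filter.frequently_or_distrib.1 <| Filter.Frequently.of_forall fun n =>
    observes_choice_iff.1 (h n)).imp observesInf_of_frequently observesInf_of_frequently

theorem ObservesInf.seq {s : ℕ → Option Ev} (h : ObservesInf P (.seq e₁ e₂) s) :
    ObservesInf P e₁ s ∨
      ∃ k, Terminates P e₁ ((List.range k).map s) ∧ ObservesInf P e₂ fun i => s (k + i) := by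
  by_cases h₁ : ObservesInf P e₁ s
  · exact .inl h₁
  obtain ⟨N, hN⟩ := not_forall.1 h₁
  have split (n : ℕ) : ∃ k ∈ Set.Iio N, Terminates P e₁ ((List.range k).map s) ∧
      Observes P e₂ ((List.range n).map fun i => s (k + i)) := by
    rcases observes_seq_iff.1 (h (N + n)) with ho | ⟨u, v, huv, ht, ho⟩
    · exact absurd (ho.mono (map_range_prefix s (Nat.le_add_right N n))) hN
    · have hlen : N + n = u.length + v.length := by simpa using congrArg List.length huv
      obtain ⟨hu, hv⟩ := map_range_eq_append huv
      rw [hu] at ht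
      rw [hv] at ho
      have hk : u.length < N := by
        by_contra! hk
        exact hN (ht.observes_prefix (map_range_prefix s hk))
      exact ⟨u.length, hk, ht, ho.mono (map_range_prefix _ (by omega))⟩
  -- The left factor ends before `N`, so one splitting point serves infinitely many prefixes.
  obtain ⟨k, -, hk⟩ := (Filter.frequently_exists_finite (Set.finite_Iio N)).1
    (Filter.Frequently.of_forall (f := atTop) split)
  exact .inr ⟨k, hk.exists.choose_spec.1, observesInf_of_frequently (hk.mono fun n hn => hn.2)⟩

theorem nontermTrace_iff_observesInf {w : Trace Ev} :
    NontermTrace P e w ↔ ∃ s, ObservesInf P e s ∧ IsErasure s w := by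
  refine exists_congr fun s => and_congr_left fun _ =>
    ⟨fun h n => h _ (hasPrefix_map_range s n), fun h u hu => ?_⟩
  rw [← hasPrefix_inf_iff.1 hu]
  exact h u.length

variable (P)

/-- The set of all traces of terminating executions of `e`. -/
def termLang (e : Expr Ev Proc) : Language Ev :=
  {w | TermTrace P e w}

theorem termLang_out (a : Ev) : termLang P (.out a) = {[a]} := by
  ext w
  constructor
  · rintro ⟨_, ⟨⟩, rfl⟩
    rfl
  · rintro rfl
    exact ⟨_, .out a, rfl⟩

theorem termLang_call (f : Proc) : termLang P (.call f) = termLang P (P f) := by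
  ext w
  constructor
  · rintro ⟨_, h, rfl⟩
    obtain ⟨v, rfl, hv⟩ := terminates_call_iff.1 h
    exact ⟨v, hv, rfl⟩
  · rintro ⟨_, h, rfl⟩
    exact ⟨_, .call h, rfl⟩

theorem termLang_seq (e₁ e₂ : Expr Ev Proc) :
    termLang P (.seq e₁ e₂) = termLang P e₁ * termLang P e₂ := by
  ext w
  rw [Language.mem_mul]
  constructor
  · rintro ⟨_, h, rfl⟩
    obtain ⟨u, v, rfl, h₁, h₂⟩ := terminates_seq_iff.1 h
    exact ⟨_, ⟨_, h₁, rfl⟩, _, ⟨_, h₂, rfl⟩, (List.reduceOption_append _ _).symm⟩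
  · rintro ⟨_, ⟨_, h₁, rfl⟩, _, ⟨_, h₂, rfl⟩, rfl⟩
    exact ⟨_, .seq h₁ h₂, (List.reduceOption_append _ _).symm⟩

theorem termLang_choice (e₁ e₂ : Expr Ev Proc) :
    termLang P (.choice e₁ e₂) = termLang P e₁ + termLang P e₂ := by
  ext w
  rw [Language.mem_add]
  constructor
  · rintro ⟨_, h, rfl⟩
    rcases terminates_choice_iff.1 h with h | h
    · exact .inl ⟨_, h, rfl⟩
    · exact .inr ⟨_, h, rfl⟩
  · rintro (⟨_, h, rfl⟩ | ⟨_, h, rfl⟩)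
    · exact ⟨_, .choice_left h, rfl⟩
    · exact ⟨_, .choice_right h, rfl⟩

open Classical in
/-- The traces of the executions of `e` up to a call of `f` that occurs in the text of `e`; calls
made while executing other procedures are not considered. -/
noncomputable def callLang (f : Proc) : Expr Ev Proc → Language Ev
  | .out _ => 0
  | .call g => if g = f then 1 else 0
  | .seq e₁ e₂ => callLang f e₁ + termLang P e₁ * callLang f e₂
  | .choice e₁ e₂ => callLang f e₁ + callLang f e₂

variable {P}

theorem mem_callLang_call {f g : Proc} {w : List Ev} :
    w ∈ callLang P f (.call g) ↔ g = f ∧ w = [] := by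
  rw [callLang]
  split_ifs with h
  · simp [h]
  · simp [h]

theorem ObservesInf.exists_call {s : ℕ → Option Ev} (h : ObservesInf P e s) :
    ∃ k f, ((List.range k).map s).reduceOption ∈ callLang P f e ∧ s k = none ∧
      ObservesInf P (P f) fun i => s (k + 1 + i) := by
  induction e generalizing s with
  | out a => exact (not_observesInf_out h).elim
  | call f =>
    obtain ⟨hs, h⟩ := h.call
    exact ⟨0, f, mem_callLang_call.2 ⟨rfl, rfl⟩, hs, by simpa only [zero_add, add_comm 1] using h⟩
  | seq e₁ e₂ ih₁ ih₂ =>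
    rcases h.seq with h | ⟨k₁, ht, h⟩
    · obtain ⟨k, f, hk, hs, h⟩ := ih₁ h
      exact ⟨k, f, .inl hk, hs, h⟩
    · obtain ⟨k₂, f, hk, hs, h⟩ := ih₂ h
      refine ⟨k₁ + k₂, f, .inr ?_, hs, by simpa only [add_assoc] using h⟩
      rw [List.range_add, List.map_append, List.map_map, List.reduceOption_append]
      exact Language.append_mem_mul ⟨_, ht, rfl⟩ hk
  | choice e₁ e₂ ih₁ ih₂ =>
    rcases h.choice with h | h
    · obtain ⟨k, f, hk, h⟩ := ih₁ h
      exact ⟨k, f, .inl hk, h⟩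
    · obtain ⟨k, f, hk, h⟩ := ih₂ h
      exact ⟨k, f, .inr hk, h⟩

theorem exists_observes_of_mem_callLang {w : List Ev} (h : w ∈ callLang P f e) :
    ∃ w' : List (Option Ev), w'.reduceOption = w ∧
      ∀ v, Observes P (.call f) v → Observes P e (w' ++ v) := by
  induction e generalizing w with
  | out a => exact h.elim
  | call g =>
    obtain ⟨rfl, rfl⟩ := mem_callLang_call.1 h
    exact ⟨[], rfl, fun _ hv => hv⟩
  | seq e₁ e₂ ih₁ ih₂ =>
    rcases h with h | ⟨_, ⟨u, hu, rfl⟩, _, h, rfl⟩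
    · obtain ⟨w', hw, ho⟩ := ih₁ h
      exact ⟨w', hw, fun v hv => .seq_left (ho v hv)⟩
    · obtain ⟨w', rfl, ho⟩ := ih₂ h
      refine ⟨u ++ w', List.reduceOption_append _ _, fun v hv => ?_⟩
      rw [List.append_assoc]
      exact .seq_right hu (ho v hv)
  | choice e₁ e₂ ih₁ ih₂ =>
    rcases h with h | h
    · obtain ⟨w', hw, ho⟩ := ih₁ h
      exact ⟨w', hw, fun v hv => .choice_left (ho v hv)⟩
    · obtain ⟨w', hw, ho⟩ := ih₂ h
      exact ⟨w', hw, fun v hv => .choice_right (ho v hv)⟩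

end Semantics

section CallPaths

open Trace
open Filter (atTop)

variable {Ev Proc : Type*} {P : Program Ev Proc} {S : Set Proc} {e : Expr Ev Proc}
  {l l' : List (List Ev × Proc)} {σ : ℕ → List Ev × Proc} {w : Trace Ev}

variable (P S) in
/-- `CallPath P S e l`: an execution of `e` can enter the calls in `l` one inside the other, none of
them a call of a procedure in `S`. Here `(w, f)` in `l` stands for the trace `w` followed by a call
of `f`; calls that have returned belong to `w` and may be of any procedure. -/
def CallPath : Expr Ev Proc → List (List Ev × Proc) → Prop
  | _, [] => True
  | e, x :: l => x.1 ∈ callLang P x.2 e ∧ x.2 ∉ S ∧ CallPath (P x.2) l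

variable (P) in
/-- The expression whose text is being executed after the call path `l` from `e`. -/
def after (e : Expr Ev Proc) (l : List (List Ev × Proc)) : Expr Ev Proc :=
  l.foldl (fun _ x => P x.2) e

theorem after_append : after P e (l ++ l') = after P (after P e l) l' :=
  List.foldl_append

theorem callPath_append : CallPath P S e (l ++ l') ↔
    CallPath P S e l ∧ CallPath P S (after P e l) l' := by
  induction l generalizing e with
  | nil => simp [CallPath, after]
  | cons x l ih =>
    simp only [List.cons_append, CallPath, ih, and_assoc]
    rfl

theorem CallPath.of_prefix (h : CallPath P S e l) (hl : l' <+: l) : CallPath P S e l' := by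
  obtain ⟨k, rfl⟩ := hl
  exact (callPath_append.1 h).1

theorem CallPath.anti {S' : Set Proc} (hS : S ⊆ S') (h : CallPath P S' e l) :
    CallPath P S e l := by
  induction l generalizing e with
  | nil => trivial
  | cons x l ih => exact ⟨h.1, fun hx => h.2.1 (hS hx), ih h.2.2⟩

theorem after_map_range_succ (n : ℕ) :
    after P e ((List.range (n + 1)).map σ) = P (σ n).2 := by
  rw [List.range_succ, List.map_append, after_append]
  rfl

theorem forall_callPath_map_range_iff : (∀ n, CallPath P S e ((List.range n).map σ)) ↔
    ∀ n, (σ n).1 ∈ callLang P (σ n).2 (after P e ((List.range n).map σ)) ∧ (σ n).2 ∉ S := by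
  have succ (n : ℕ) : CallPath P S e ((List.range (n + 1)).map σ) ↔
      CallPath P S e ((List.range n).map σ) ∧
        (σ n).1 ∈ callLang P (σ n).2 (after P e ((List.range n).map σ)) ∧ (σ n).2 ∉ S := by
    rw [List.range_succ, List.map_append, callPath_append]
    simp [CallPath]
  refine ⟨fun h n => ((succ n).1 (h (n + 1))).2, fun h n => ?_⟩
  induction n with
  | zero => trivial
  | succ n ih => exact (succ n).2 ⟨ih, h n⟩

variable (P S) in
/-- The traces of the nonterminating executions of `e` in which every call of a procedure in `S`
returns. Such an execution enters infinitely many calls that never return, one inside the other. -/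
def Diverges (e : Expr Ev Proc) : Set (Trace Ev) :=
  {w | ∃ σ : ℕ → List Ev × Proc, (∀ n, CallPath P S e ((List.range n).map σ)) ∧
    IsInfCat (fun n => (σ n).1) w}

theorem reduceOption_eq_flatMap_toList {α : Type*} (l : List (Option α)) :
    l.reduceOption = l.flatMap Option.toList :=
  List.filterMap_eq_flatMap_toList id l

theorem mem_diverges_of_observesInf {s : ℕ → Option Ev} (h : ObservesInf P e s)
    (hw : IsErasure s w) : w ∈ Diverges P ∅ e := by
  let State := {x : Expr Ev Proc × ℕ // ObservesInf P x.1 fun i => s (x.2 + i)}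
  have step (x : State) : ∃ (y : State) (f : Proc), x.1.2 < y.1.2 ∧ y.1.1 = P f ∧
      (List.Ico x.1.2 y.1.2).flatMap (fun i => (s i).toList) ∈ callLang P f x.1.1 := by
    obtain ⟨⟨e, m⟩, h⟩ := x
    obtain ⟨k, f, hk, hs, h⟩ := h.exists_call
    refine ⟨⟨(P f, m + k + 1), by simpa only [add_assoc] using h⟩, f, by grind, rfl, ?_⟩
    rw [List.Ico.succ_top (Nat.le_add_right m k), List.flatMap_append]
    simpa [hs, List.Ico, List.range'_eq_map_range, List.flatMap_map,
      reduceOption_eq_flatMap_toList] using hk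
  choose next proc hlt hexpr hmem using step
  let x (n : ℕ) : State := next^[n] ⟨(e, 0), by simpa using h⟩
  have x_succ (n : ℕ) : x (n + 1) = next (x n) := Function.iterate_succ_apply' ..
  let σ (n : ℕ) := ((List.Ico (x n).1.2 (x (n + 1)).1.2).flatMap fun i => (s i).toList, proc (x n))
  have after_eq : ∀ n, after P e ((List.range n).map σ) = (x n).1.1
    | 0 => rfl
    | n + 1 => by rw [after_map_range_succ, x_succ, hexpr]
  refine ⟨σ, forall_callPath_map_range_iff.2 fun n => ⟨?_, Set.notMem_empty _⟩,
    (isInfCat_group (strictMono_nat_of_lt_succ fun n => x_succ n ▸ hlt (x n)) rfl).2 hw⟩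
  rw [after_eq]
  simpa only [σ, x_succ] using hmem (x n)

theorem exists_observesInf_of_mem_diverges (h : w ∈ Diverges P S e) :
    ∃ s, ObservesInf P e s ∧ IsErasure s w := by
  obtain ⟨σ, hσ, hw⟩ := h
  choose t ht hobs using fun n =>
    exists_observes_of_mem_callLang (forall_callPath_map_range_iff.1 hσ n).1
  obtain ⟨s, hs⟩ := exists_isInfCat_inf (u := fun n => t n ++ [none])
    (Filter.Frequently.of_forall fun n => by simp)
  have observes (n : ℕ) : ∀ v, Observes P (after P e ((List.range n).map σ)) v →
      Observes P e (partialCat (fun n => t n ++ [none]) n ++ v) := by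
    induction n with
    | zero => exact fun v hv => hv
    | succ n ih =>
      intro v hv
      rw [after_map_range_succ] at hv
      simpa [partialCat_succ] using ih _ (hobs n _ (.call hv))
  refine ⟨s, fun n => ?_, (hs.flatMap_iff Option.toList).1 ?_⟩
  · obtain ⟨m, hm⟩ := hs.exists_map_range_prefix n
    exact (observes m [] (.nil _)).mono (hm.trans (List.prefix_append _ _))
  · simpa [← reduceOption_eq_flatMap_toList, ht] using hw

theorem nontermTrace_iff_mem_diverges : NontermTrace P e w ↔ w ∈ Diverges P ∅ e :=
  nontermTrace_iff_observesInf.trans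
    ⟨fun ⟨_, hs, hw⟩ => mem_diverges_of_observesInf hs hw, exists_observesInf_of_mem_diverges⟩

end CallPaths

section Runs

open Trace

variable {Ev Proc : Type*} {P : Program Ev Proc} {S : Set Proc} {e e₁ e₂ : Expr Ev Proc}
  {f g : Proc} {w : List Ev}

variable (P S) in
/-- The traces of the executions of `e` up to a call of `g` such that no call of a procedure in `S`
is open then; the call of `g` is reached, but not entered, so `g ∈ S` is allowed. -/
def runLang (e : Expr Ev Proc) (g : Proc) : Language Ev :=
  {w | ∃ l, CallPath P S e l ∧ ∃ v ∈ callLang P g (after P e l), l.flatMap Prod.fst ++ v = w}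

theorem mem_runLang_iff : w ∈ runLang P S e g ↔
    w ∈ callLang P g e ∨
      ∃ f ∉ S, ∃ a ∈ callLang P f e, ∃ v ∈ runLang P S (P f) g, a ++ v = w := by
  constructor
  · rintro ⟨_ | ⟨⟨a, f⟩, l⟩, hl, v, hv, rfl⟩
    · exact .inl hv
    · exact .inr ⟨f, hl.2.1, a, hl.1, _, ⟨l, hl.2.2, v, hv, rfl⟩, (List.append_assoc ..).symm⟩
  · rintro (hw | ⟨f, hf, a, ha, _, ⟨l, hl, v, hv, rfl⟩, rfl⟩)
    · exact ⟨[], trivial, w, hw, rfl⟩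
    · exact ⟨(a, f) :: l, ⟨ha, hf, hl⟩, v, hv, List.append_assoc ..⟩

theorem runLang_anti {S' : Set Proc} (hS : S ⊆ S') : runLang P S' e g ≤ runLang P S e g :=
  fun _ ⟨l, hl, hw⟩ => ⟨l, hl.anti hS, hw⟩

theorem exists_callPath_of_mem_runLang (hf : f ∉ S) (hw : w ∈ runLang P S e f) :
    ∃ l, l ≠ [] ∧ CallPath P S e l ∧ after P e l = P f ∧ l.flatMap Prod.fst = w := by
  obtain ⟨l, hl, v, hv, rfl⟩ := hw
  exact ⟨l ++ [(v, f)], by simp, callPath_append.2 ⟨hl, hv, hf, trivial⟩, after_append, by simp⟩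

theorem runLang_mul_runLang_le (hf : f ∉ S) :
    runLang P S e f * runLang P S (P f) g ≤ runLang P S e g := by
  rintro _ ⟨u, hu, _, ⟨l', hl', v, hv, rfl⟩, rfl⟩
  obtain ⟨l, -, hl, hafter, rfl⟩ := exists_callPath_of_mem_runLang hf hu
  rw [← hafter] at hl' hv
  exact ⟨l ++ l', callPath_append.2 ⟨hl, hl'⟩, v, by rwa [after_append], by simp⟩

theorem runLang_seq (S : Set Proc) (g : Proc) :
    runLang P S (.seq e₁ e₂) g = runLang P S e₁ g + termLang P e₁ * runLang P S e₂ g := by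
  ext w
  rw [Language.mem_add, Language.mem_mul, mem_runLang_iff, mem_runLang_iff]
  constructor
  · rintro ((h | ⟨a, ha, b, hb, rfl⟩) | ⟨f, hf, _, h | ⟨c, hc, b, hb, rfl⟩, v, hv, rfl⟩)
    · exact .inl (.inl h)
    · exact .inr ⟨a, ha, b, mem_runLang_iff.2 (.inl hb), rfl⟩
    · exact .inl (.inr ⟨f, hf, _, h, v, hv, rfl⟩)
    · exact .inr ⟨c, hc, _, mem_runLang_iff.2 (.inr ⟨f, hf, b, hb, v, hv, rfl⟩),
        (List.append_assoc ..).symm⟩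
  · rintro ((h | ⟨f, hf, a, h, v, hv, rfl⟩) | ⟨a, ha, _, hb, rfl⟩)
    · exact .inl (.inl h)
    · exact .inr ⟨f, hf, a, .inl h, v, hv, rfl⟩
    · rcases mem_runLang_iff.1 hb with hb | ⟨f, hf, c, hc, v, hv, rfl⟩
      · exact .inl (.inr ⟨a, ha, _, hb, rfl⟩)
      · exact .inr ⟨f, hf, a ++ c, .inr ⟨a, ha, c, hc, rfl⟩, v, hv, List.append_assoc ..⟩

theorem runLang_choice (S : Set Proc) (g : Proc) :
    runLang P S (.choice e₁ e₂) g = runLang P S e₁ g + runLang P S e₂ g := by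
  ext w
  rw [Language.mem_add, mem_runLang_iff, mem_runLang_iff (e := e₁), mem_runLang_iff (e := e₂)]
  simp only [callLang, Language.mem_add]
  grind

theorem mem_runLang_call : w ∈ runLang P S (.call f) g ↔
    (f = g ∧ w = []) ∨ f ∉ S ∧ w ∈ runLang P S (P f) g := by
  rw [mem_runLang_iff]
  simp only [mem_callLang_call]
  refine or_congr_right ⟨?_, fun ⟨hf, hw⟩ => ⟨f, hf, [], ⟨rfl, rfl⟩, w, hw, rfl⟩⟩
  rintro ⟨_, hf, _, ⟨rfl, rfl⟩, v, hv, rfl⟩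
  exact ⟨hf, hv⟩

/-- Kleene's state elimination: a run is cut at the calls of `f` that are open at its end. -/
theorem runLang_eq_add_mul_kstar_mul (hf : f ∉ S) (e : Expr Ev Proc) (g : Proc) :
    runLang P S e g = runLang P (insert f S) e g + runLang P (insert f S) e f *
      ((runLang P (insert f S) (P f) f)∗ * runLang P (insert f S) (P f) g) := by
  have hS : S ⊆ insert f S := Set.subset_insert f S
  refine le_antisymm ?_ (sup_le (runLang_anti hS) ?_)
  · rintro _ ⟨l, hl, v, hv, rfl⟩
    induction l generalizing e with
    | nil => exact .inl (mem_runLang_iff.2 (.inl hv))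
    | cons x l ih =>
      obtain ⟨a, h⟩ := x
      obtain ⟨ha, hh, hl⟩ := hl
      rw [List.flatMap_cons, List.append_assoc]
      have ih := ih (P h) hl hv
      by_cases hhf : h = f
      · subst hhf
        refine .inr (Language.append_mem_mul (mem_runLang_iff.2 (.inl ha)) ?_)
        rwa [← mul_assoc, ← one_add_mul, Language.one_add_self_mul_kstar_eq_kstar] at ih
      · have hhS : h ∉ insert f S := by simp [hhf, hh]
        rcases ih with ih | ⟨u, hu, x, hx, hux⟩
        · exact .inl (mem_runLang_iff.2 (.inr ⟨h, hhS, a, ha, _, ih, rfl⟩))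
        · exact .inr ⟨a ++ u, mem_runLang_iff.2 (.inr ⟨h, hhS, a, ha, u, hu, rfl⟩), x, hx,
            by rw [← hux]; exact List.append_assoc ..⟩
  · have hstar : (runLang P (insert f S) (P f) f)∗ * runLang P (insert f S) (P f) g ≤
        runLang P S (P f) g :=
      kstar_mul_le (runLang_anti hS)
        ((mul_le_mul_left (runLang_anti hS) _).trans (runLang_mul_runLang_le hf))
    exact (mul_le_mul' (runLang_anti hS) hstar).trans (runLang_mul_runLang_le hf)

theorem runLang_eq_kstar_mul (hf : f ∉ S) (g : Proc) :
    runLang P S (P f) g = (runLang P (insert f S) (P f) f)∗ * runLang P (insert f S) (P f) g := by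
  rw [runLang_eq_add_mul_kstar_mul hf, ← mul_assoc, ← one_add_mul,
    Language.one_add_self_mul_kstar_eq_kstar]

end Runs

section Divergence

open Trace
open Filter (atTop)

variable {Ev Proc : Type*} {P : Program Ev Proc} {S : Set Proc} {e e₁ e₂ : Expr Ev Proc}
  {f : Proc} {l : List (List Ev × Proc)} {σ : ℕ → List Ev × Proc} {w : Trace Ev}

theorem mem_diverges_iff : w ∈ Diverges P S e ↔
    ∃ f ∉ S, ∃ a ∈ callLang P f e, ∃ v ∈ Diverges P S (P f), w = append a v := by
  constructor
  · rintro ⟨σ, hσ, hw⟩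
    obtain ⟨v, rfl, hv⟩ := hw.tail
    have cons (n : ℕ) := hσ (n + 1)
    simp only [List.range_succ_eq_map, List.map_cons, List.map_map, CallPath] at cons
    exact ⟨_, (cons 0).2.1, _, (cons 0).1, v, ⟨fun n => σ (n + 1), fun n => (cons n).2.2, hv⟩, rfl⟩
  · rintro ⟨f, hf, a, ha, v, ⟨σ, hσ, hv⟩, rfl⟩
    refine ⟨fun n => n.casesOn (a, f) σ, fun n => ?_, ?_⟩
    · cases n with
      | zero => trivial
      | succ n =>
        simp only [List.range_succ_eq_map, List.map_cons, List.map_map]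
        exact ⟨ha, hf, hσ n⟩
    · convert hv.cons a using 2 with n
      cases n <;> rfl

theorem diverges_anti {S' : Set Proc} (hS : S ⊆ S') : Diverges P S' e ⊆ Diverges P S e :=
  fun _ ⟨σ, hσ, hw⟩ => ⟨σ, fun n => (hσ n).anti hS, hw⟩

theorem diverges_seq (S : Set Proc) (e₁ e₂ : Expr Ev Proc) :
    Diverges P S (.seq e₁ e₂) = Diverges P S e₁ ∪ catSet (termLang P e₁) (Diverges P S e₂) := by
  ext w
  rw [Set.mem_union, mem_diverges_iff, mem_diverges_iff (e := e₁)]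
  constructor
  · rintro ⟨f, hf, _, h | ⟨c, hc, b, hb, rfl⟩, v, hv, rfl⟩
    · exact .inl ⟨f, hf, _, h, v, hv, rfl⟩
    · exact .inr ⟨c, hc, _, mem_diverges_iff.2 ⟨f, hf, b, hb, v, hv, rfl⟩, append_append ..⟩
  · rintro (⟨f, hf, a, h, v, hv, rfl⟩ | ⟨a, ha, b, hb, rfl⟩)
    · exact ⟨f, hf, a, .inl h, v, hv, rfl⟩
    · obtain ⟨f, hf, c, hc, v, hv, rfl⟩ := mem_diverges_iff.1 hb
      exact ⟨f, hf, a ++ c, .inr ⟨a, ha, c, hc, rfl⟩, v, hv, (append_append ..).symm⟩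

theorem diverges_choice (S : Set Proc) (e₁ e₂ : Expr Ev Proc) :
    Diverges P S (.choice e₁ e₂) = Diverges P S e₁ ∪ Diverges P S e₂ := by
  ext w
  rw [Set.mem_union, mem_diverges_iff, mem_diverges_iff (e := e₁), mem_diverges_iff (e := e₂)]
  simp only [callLang, Language.mem_add]
  grind

theorem mem_diverges_call : w ∈ Diverges P S (.call f) ↔ f ∉ S ∧ w ∈ Diverges P S (P f) := by
  rw [mem_diverges_iff]
  simp only [mem_callLang_call]
  constructor
  · rintro ⟨_, hf, _, ⟨rfl, rfl⟩, v, hv, rfl⟩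
    exact ⟨hf, by rwa [append_nil]⟩
  · exact fun ⟨hf, hw⟩ => ⟨f, hf, [], ⟨rfl, rfl⟩, w, hw, (append_nil w).symm⟩

theorem catSet_runLang_diverges_subset (hf : f ∉ S) :
    catSet (runLang P S e f) (Diverges P S (P f)) ⊆ Diverges P S e := by
  rintro _ ⟨_, ⟨l, hl, v, hv, rfl⟩, w, hw, rfl⟩
  induction l generalizing e with
  | nil => exact mem_diverges_iff.2 ⟨f, hf, v, hv, w, hw, rfl⟩
  | cons x l ih =>
    exact mem_diverges_iff.2 ⟨x.2, hl.2.1, x.1, hl.1, _, ih hl.2.2 hv,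
      by rw [List.flatMap_cons, List.append_assoc, append_append]⟩

theorem omegaPow_mono {U V : Set (List Ev)} (h : U ⊆ V) : omegaPow U ⊆ omegaPow V :=
  fun _ ⟨u, hu, hw⟩ => ⟨u, fun i => h (hu i), hw⟩

theorem omegaPow_kstar_mul_subset (U : Language Ev) :
    omegaPow (U∗ * U : Language Ev) ⊆ omegaPow U := by
  rintro w ⟨u, hu, hw⟩
  have factors (i : ℕ) : ∃ l : List (List Ev), l ≠ [] ∧ (∀ y ∈ l, y ∈ U) ∧ l.flatMap id = u i := by
    obtain ⟨_, ⟨l, rfl, hl⟩, b, hb, hab⟩ := hu i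
    exact ⟨l ++ [b], by simp, List.forall_mem_append.2 ⟨hl, List.forall_mem_singleton.2 hb⟩,
      by simpa using hab⟩
  choose l hne hl hlu using factors
  obtain ⟨s, hs⟩ := exists_isInfCat_inf (Filter.Frequently.of_forall hne)
  refine ⟨s, fun n => ?_, (hs.flatMap_iff id).1 (by simpa only [hlu] using hw)⟩
  obtain ⟨m, hm⟩ := hs.exists_map_range_prefix (n + 1)
  obtain ⟨i, -, hi⟩ := List.mem_flatMap.1 <|
    hm.subset (List.mem_map_of_mem List.self_mem_range_succ)
  exact hl i _ hi

theorem omegaPow_runLang_subset_diverges (hf : f ∉ S) :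
    omegaPow (runLang P S (P f) f) ⊆ Diverges P S (P f) := by
  rintro w ⟨u, hu, hw⟩
  choose l hne hl hafter hlu using fun i => exists_callPath_of_mem_runLang hf (hu i)
  obtain ⟨σ, hσ⟩ := exists_isInfCat_inf (Filter.Frequently.of_forall hne)
  have path (n : ℕ) :
      CallPath P S (P f) (partialCat l n) ∧ after P (P f) (partialCat l n) = P f := by
    induction n with
    | zero => exact ⟨trivial, rfl⟩
    | succ n ih =>
      rw [partialCat_succ, callPath_append, after_append, ih.2]
      exact ⟨⟨ih.1, hl n⟩, hafter n⟩
  refine ⟨σ, fun n => ?_, (hσ.flatMap_iff Prod.fst).1 (by simpa only [hlu] using hw)⟩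
  obtain ⟨m, hm⟩ := hσ.exists_map_range_prefix n
  exact (path m).1.of_prefix hm

theorem map_range_append_map_Ico {α : Type*} (s : ℕ → α) {a b : ℕ} (h : a ≤ b) :
    (List.range a).map s ++ (List.Ico a b).map s = (List.range b).map s := by
  rw [← List.map_append, ← List.Ico.zero_bot, ← List.Ico.zero_bot,
    List.Ico.append_consecutive a.zero_le h]

theorem flatMap_Ico_mem_runLang (hσ : ∀ n, CallPath P S e ((List.range n).map σ)) {a m : ℕ}
    (h : a ≤ m) : (List.Ico a (m + 1)).flatMap (fun n => (σ n).1) ∈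
      runLang P S (after P e ((List.range a).map σ)) (σ m).2 := by
  have call := (forall_callPath_map_range_iff.1 hσ m).1
  have path := hσ m
  rw [← map_range_append_map_Ico σ h] at call path
  rw [after_append] at call
  refine ⟨_, (callPath_append.1 path).2, _, call, ?_⟩
  rw [List.Ico.succ_top h, List.flatMap_append, List.flatMap_map]
  simp

theorem CallPath.insert (h : CallPath P S e l) (hl : ∀ x ∈ l, x.2 ≠ f) :
    CallPath P (insert f S) e l := by
  induction l generalizing e with
  | nil => trivial
  | cons x l ih =>
    obtain ⟨hx, hl⟩ := List.forall_mem_cons.1 hl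
    exact ⟨h.1, by simp [hx, h.2.1], ih h.2.2 hl⟩

theorem mem_diverges_insert_of_drop (hσ : ∀ n, CallPath P S e ((List.range n).map σ)) {N : ℕ}
    (hN : ∀ n, N ≤ n → (σ n).2 ≠ f) (hw : IsInfCat (fun n => (σ (N + n)).1) w) :
    w ∈ Diverges P (insert f S) (after P e ((List.range N).map σ)) := by
  refine ⟨fun n => σ (N + n), fun n => CallPath.insert ?_ ?_, hw⟩
  · have := hσ (N + n)
    rw [List.range_add, List.map_append, callPath_append, List.map_map] at this
    exact this.2
  · simp only [List.mem_map, List.mem_range]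
    rintro _ ⟨i, -, rfl⟩
    exact hN _ (Nat.le_add_right N i)

theorem mem_omegaPow_of_frequently (hσ : ∀ n, CallPath P S (P f) ((List.range n).map σ))
    (hf : ∃ᶠ n in atTop, (σ n).2 = f) (hw : IsInfCat (fun n => (σ n).1) w) :
    w ∈ omegaPow (runLang P S (P f) f) := by
  obtain ⟨k, hk, hkf⟩ := Filter.extraction_of_frequently_atTop hf
  let c : ℕ → ℕ := fun n => n.casesOn 0 fun n => k n + 1
  have hc : StrictMono c := strictMono_nat_of_lt_succ fun n => by
    cases n with
    | zero => exact Nat.succ_pos _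
    | succ n => exact Nat.succ_lt_succ (hk n.lt_succ_self)
  have after_c (n : ℕ) : after P (P f) ((List.range (c n)).map σ) = P f := by
    cases n with
    | zero => rfl
    | succ n => rw [after_map_range_succ, hkf]
  refine ⟨_, fun i => ?_, (isInfCat_group hc rfl).2 hw⟩
  have run := flatMap_Ico_mem_runLang hσ (Nat.le_of_lt_succ (hc i.lt_succ_self))
  rwa [after_c, hkf] at run

theorem mem_catSet_of_eventually (hσ : ∀ n, CallPath P S (P f) ((List.range n).map σ))
    (hf : ∀ᶠ n in atTop, (σ n).2 ≠ f) (hw : IsInfCat (fun n => (σ n).1) w) :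
    w ∈ catSet (1 + runLang P S (P f) f : Language Ev) (Diverges P (insert f S) (P f)) := by
  classical
  rw [Filter.eventually_atTop] at hf
  obtain ⟨r, rfl, hr⟩ := hw.drop (Nat.find hf)
  have hr := mem_diverges_insert_of_drop hσ (Nat.find_spec hf) hr
  obtain h | ⟨m, h⟩ : Nat.find hf = 0 ∨ ∃ m, Nat.find hf = m + 1 :=
    Nat.eq_zero_or_eq_succ_pred _ |>.imp_right fun h => ⟨_, h⟩
  · rw [h] at hr ⊢
    exact ⟨[], .inl rfl, r, hr, rfl⟩
  · have hm : (σ m).2 = f := by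
      have := Nat.find_min hf (m := m) (by omega)
      have := Nat.find_spec hf
      grind
    rw [h, after_map_range_succ, hm] at hr
    have run := flatMap_Ico_mem_runLang hσ m.zero_le
    rw [List.Ico.zero_bot, hm] at run
    exact ⟨_, .inr run, r, hr, by rw [h]; rfl⟩

/-- State elimination for infinite runs: finitely or infinitely many calls of `f` never return. -/
theorem diverges_eq_union (hf : f ∉ S) :
    Diverges P S (P f) =
      catSet ((runLang P (insert f S) (P f) f)∗ : Language Ev) (Diverges P (insert f S) (P f)) ∪
        omegaPow (runLang P (insert f S) (P f) f) := by
  have hS : S ⊆ insert f S := Set.subset_insert f S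
  have run_eq := runLang_eq_kstar_mul (P := P) hf f
  have one_add_run : 1 + runLang P S (P f) f = (runLang P (insert f S) (P f) f)∗ := by
    rw [run_eq, Language.one_add_kstar_mul_self_eq_kstar]
  refine Set.Subset.antisymm ?_ (Set.union_subset ?_ ?_)
  · rintro w ⟨σ, hσ, hw⟩
    by_cases h : ∃ᶠ n in atTop, (σ n).2 = f
    · right
      have := mem_omegaPow_of_frequently hσ h hw
      rw [run_eq] at this
      exact omegaPow_kstar_mul_subset _ this
    · rw [← one_add_run]
      exact .inl (mem_catSet_of_eventually hσ (Filter.not_frequently.1 h) hw)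
  · rw [← one_add_run]
    rintro _ ⟨u, rfl | hu, v, hv, rfl⟩
    · rw [append_nil]
      exact diverges_anti hS hv
    · exact catSet_runLang_diverges_subset hf ⟨u, hu, v, diverges_anti hS hv, rfl⟩
  · exact (omegaPow_mono (runLang_anti hS)).trans (omegaPow_runLang_subset_diverges hf)

end Divergence

attribute [ext] EffExpr

section ExactEffects

open Trace

variable {Q Ev Proc Var : Type*} (𝔄 : ExtBuchi Q Ev) (procVar : Proc ↪ Var)

section Abstraction

variable {S : Set Proc} {R R' : Proc → Language Ev} {V V' : Set (Trace Ev)} {f : Proc}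

/-- The abstraction of the expression `⋃_{g ∈ S} R g ⬝ X_g ∪ V`, where `X_g` is the variable of the
procedure `g`. -/
def alphaExpr (S : Set Proc) (R : Proc → Language Ev) (V : Set (Trace Ev)) : EffExpr 𝔄 Var where
  coeff X := {C | ∃ g ∈ S, procVar g = X ∧ C ∈ 𝔄.alphaStar (R g)}
  base := 𝔄.alphaOmega V

theorem alphaExpr_congr (hR : ∀ g ∈ S, R g = R' g) (hV : V = V') :
    alphaExpr 𝔄 procVar S R V = alphaExpr 𝔄 procVar S R' V' := by
  ext X C
  · refine exists_congr fun g => and_congr_right fun hg => ?_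
    rw [hR g hg]
  · rw [alphaExpr, hV, alphaExpr]

theorem union_alphaExpr : (alphaExpr 𝔄 procVar S R V).union (alphaExpr 𝔄 procVar S R' V') =
    alphaExpr 𝔄 procVar S (fun g => R g + R' g) (V ∪ V') := by
  ext X C
  · simp only [EffExpr.union, alphaExpr, 𝔄.alphaStar_add, Set.mem_union, Set.mem_ofPred_eq]
    grind
  · simp only [EffExpr.union, alphaExpr, 𝔄.alphaOmega_union]

theorem cat_alphaExpr [Finite Q] (U : Language Ev) :
    (alphaExpr 𝔄 procVar S R V).cat (𝔄.alphaStar U) =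
      alphaExpr 𝔄 procVar S (fun g => U * R g) (catSet U V) := by
  refine EffExpr.ext (funext fun X => Set.ext fun C => ?_) (𝔄.alphaOmega_catSet U V).symm
  simp only [EffExpr.cat, alphaExpr, 𝔄.alphaStar_mul, ExtBuchi.starCat, Set.mem_ofPred_eq]
  grind

theorem alphaExpr_zero :
    alphaExpr 𝔄 procVar S (fun _ => 0) V = .const (𝔄.alphaOmega V) := by
  ext X C
  · simp [alphaExpr, EffExpr.const, 𝔄.alphaStar_zero]
  · rfl

theorem alphaExpr_empty : alphaExpr 𝔄 procVar ∅ R V = .const (𝔄.alphaOmega V) := by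
  ext X C
  · simp [alphaExpr, EffExpr.const]
  · rfl

open Classical in
theorem alphaExpr_single (hf : f ∈ S) :
    alphaExpr 𝔄 procVar S (fun g => if f = g then 1 else 0) ∅ = .var (procVar f) := by
  ext X C
  · simp only [alphaExpr, EffExpr.var, Set.mem_ofPred_eq]
    constructor
    · rintro ⟨g, -, rfl, hC⟩
      split_ifs at hC with h
      · simpa [h, 𝔄.alphaStar_one] using hC
      · rw [𝔄.alphaStar_zero] at hC
        exact hC.elim
    · intro hC
      split_ifs at hC with h
      · exact ⟨f, hf, h.symm, by rwa [if_pos rfl, 𝔄.alphaStar_one]⟩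
      · exact hC.elim
  · rw [alphaExpr, 𝔄.alphaOmega_empty, EffExpr.var]

theorem alphaExpr_insert : alphaExpr 𝔄 procVar (insert f S) R V =
    ((EffExpr.var (procVar f)).cat (𝔄.alphaStar (R f))).union (alphaExpr 𝔄 procVar S R V) := by
  ext X C
  · by_cases hX : X = procVar f
    · simp [alphaExpr, EffExpr.union, EffExpr.cat, EffExpr.var, ExtBuchi.starCat, hX]
    · simp [alphaExpr, EffExpr.union, EffExpr.cat, EffExpr.var, ExtBuchi.starCat, hX, Ne.symm hX]
  · simp [alphaExpr, EffExpr.union, EffExpr.cat, EffExpr.var, ExtBuchi.omegaUnion,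
      ExtBuchi.omegaCat, ExtBuchi.catPairs, ExtBuchi.omegaEmpty]

theorem alphaExpr_avoids (hf : f ∉ S) :
    (alphaExpr 𝔄 procVar S R V).Avoids (procVar f) := by
  refine Set.eq_empty_of_forall_notMem ?_
  rintro C ⟨g, hg, h, -⟩
  exact hf (procVar.injective h ▸ hg)

end Abstraction

variable (P : Program Ev Proc) {S : Set Proc} {f : Proc}

/-- The exact effect of the terminating executions of `e`. -/
def termEff (e : Expr Ev Proc) : 𝔄.MStar :=
  𝔄.alphaStar (termLang P e)

/-- The exact effect of the nonterminating executions of `e`, in which the calls of procedures in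
`S` are represented by their variables. -/
def divEff (S : Set Proc) (e : Expr Ev Proc) : EffExpr 𝔄 Var :=
  alphaExpr 𝔄 procVar S (runLang P S e) (Diverges P S e)

/-- The environment that assigns their exact effects to the procedures in `S`. -/
def exactEnv (S : Set Proc) : Env 𝔄 Proc Var where
  items := {b | ∃ g ∈ S, b = ⟨g, termEff 𝔄 P (.call g), procVar g⟩}
  distinct := by
    rintro _ ⟨g, -, rfl⟩ _ ⟨g', -, rfl⟩ h
    obtain rfl := procVar.injective h
    rfl

theorem exactEnv_empty : exactEnv 𝔄 procVar P ∅ = Env.empty := by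
  simp [exactEnv, Env.empty]

theorem exactEnv_fresh (hf : f ∉ S) : (exactEnv 𝔄 procVar P S).Fresh (procVar f) := by
  rintro _ ⟨g, hg, rfl⟩ h
  exact hf (procVar.injective h ▸ hg)

theorem exactEnv_extend (hf : f ∉ S) :
    (exactEnv 𝔄 procVar P S).extend f (termEff 𝔄 P (.call f)) (procVar f)
      (exactEnv_fresh 𝔄 procVar P hf) = exactEnv 𝔄 procVar P (insert f S) := by
  simp only [Env.extend, exactEnv, Env.mk.injEq]
  ext b
  simp

theorem divEff_out (S : Set Proc) (a : Ev) :
    divEff 𝔄 procVar P S (.out a) = .const 𝔄.omegaEmpty := by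
  have runLang_out (g : Proc) : runLang P S (.out a) g = 0 := by
    refine Set.eq_empty_of_forall_notMem fun w hw => ?_
    obtain h | ⟨_, -, _, h, -⟩ := mem_runLang_iff.1 hw <;> exact h
  have diverges_out : Diverges P S (.out a) = ∅ :=
    Set.eq_empty_of_forall_notMem fun w hw =>
      let ⟨_, _, _, h, _⟩ := mem_diverges_iff.1 hw
      h
  rw [divEff, alphaExpr_congr 𝔄 procVar (fun g _ => runLang_out g) diverges_out, alphaExpr_zero,
    𝔄.alphaOmega_empty]

theorem divEff_seq [Finite Q] (S : Set Proc) (e₁ e₂ : Expr Ev Proc) :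
    divEff 𝔄 procVar P S (.seq e₁ e₂) =
      (divEff 𝔄 procVar P S e₁).union ((divEff 𝔄 procVar P S e₂).cat (termEff 𝔄 P e₁)) := by
  simp only [divEff, termEff, cat_alphaExpr, union_alphaExpr]
  exact alphaExpr_congr 𝔄 procVar (fun g _ => runLang_seq S g) (diverges_seq S e₁ e₂)

theorem divEff_choice (S : Set Proc) (e₁ e₂ : Expr Ev Proc) :
    divEff 𝔄 procVar P S (.choice e₁ e₂) =
      (divEff 𝔄 procVar P S e₁).union (divEff 𝔄 procVar P S e₂) := by
  simp only [divEff, union_alphaExpr]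
  exact alphaExpr_congr 𝔄 procVar (fun g _ => runLang_choice S g) (diverges_choice S e₁ e₂)

theorem divEff_call_of_mem (hf : f ∈ S) :
    divEff 𝔄 procVar P S (.call f) = .var (procVar f) := by
  rw [← alphaExpr_single 𝔄 procVar hf]
  refine alphaExpr_congr 𝔄 procVar (fun g _ => ?_) ?_
  · ext w
    rw [mem_runLang_call, ← mem_callLang_call (P := P), callLang]
    exact or_iff_left fun h => h.1 hf
  · exact Set.eq_empty_of_forall_notMem fun w hw => (mem_diverges_call.1 hw).1 hf

theorem divEff_call_of_notMem [Finite Q] (hf : f ∉ S) :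
    divEff 𝔄 procVar P S (.call f) =
      ((alphaExpr 𝔄 procVar S (runLang P (insert f S) (P f)) (Diverges P (insert f S) (P f))).cat
        (𝔄.starIter (𝔄.alphaStar (runLang P (insert f S) (P f) f)))).union
      (.const (𝔄.omegaIter (𝔄.alphaStar (runLang P (insert f S) (P f) f)))) := by
  rw [← 𝔄.alphaStar_kstar, ← 𝔄.alphaOmega_omegaPow (runLang P (insert f S) (P f) f), cat_alphaExpr,
    ← alphaExpr_zero 𝔄 procVar, union_alphaExpr]
  refine alphaExpr_congr 𝔄 procVar (fun g hg => ?_) ?_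
  · rw [add_zero, ← runLang_eq_kstar_mul hf]
    ext w
    have hfg : f ≠ g := fun h => hf (h ▸ hg)
    simp [mem_runLang_call, hfg, hf]
  · rw [← diverges_eq_union hf]
    ext w
    simp [mem_diverges_call, hf]

theorem derives_exact [Finite Q] [Finite Proc] (S : Set Proc) (e : Expr Ev Proc) :
    Derives 𝔄 P (exactEnv 𝔄 procVar P S) e (termEff 𝔄 P e) (divEff 𝔄 procVar P S e) := by
  induction S using (wellFounded_gt (α := Set Proc)).induction generalizing e with
  | _ S ihS =>
    induction e with
    | out a =>
      rw [divEff_out, termEff, termLang_out]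
      exact .out _ a
    | seq e₁ e₂ ih₁ ih₂ =>
      rw [divEff_seq, termEff, termLang_seq, 𝔄.alphaStar_mul]
      exact .seq ih₁ ih₂
    | choice e₁ e₂ ih₁ ih₂ =>
      rw [divEff_choice, termEff, termLang_choice, 𝔄.alphaStar_add]
      exact .choice ih₁ ih₂
    | call f =>
      by_cases hf : f ∈ S
      · rw [divEff_call_of_mem 𝔄 procVar P hf]
        exact .hyp ⟨f, hf, rfl⟩
      · rw [divEff_call_of_notMem 𝔄 procVar P hf]
        refine .fix (exactEnv_fresh 𝔄 procVar P hf) (alphaExpr_avoids 𝔄 procVar hf) ?_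
        rw [exactEnv_extend 𝔄 procVar P hf, ← alphaExpr_insert, termEff, termLang_call]
        exact ihS _ (Set.ssubset_insert hf) (P f)

theorem traces_eq_union (f : Proc) :
    traces P f = fin '' termLang P (.call f) ∪ Diverges P ∅ (.call f) := by
  ext w
  simp only [traces, nontermTrace_iff_mem_diverges, termLang, Set.mem_union, Set.mem_image,
    Set.mem_ofPred_eq]
  grind

end ExactEffects

end BuchiEffect

theorem mainTheorem1 {Q Ev Proc Var : Type*} [Finite Q] [Finite Proc]
    (𝔄 : BuchiEffect.ExtBuchi Q Ev) (P : BuchiEffect.Program Ev Proc)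
    (procVar : Proc ↪ Var) (f : Proc) :
    ∃ (𝒰 : 𝔄.MStar) (𝒱 : 𝔄.MOmega),
      BuchiEffect.Derives 𝔄 P (BuchiEffect.Env.empty : BuchiEffect.Env 𝔄 Proc Var)
        (.call f) 𝒰 (.const 𝒱) ∧
      (BuchiEffect.traces P f ⊆ 𝔄.lang ↔
        BuchiEffect.Trace.fin '' 𝔄.gammaStar 𝒰 ∪ 𝔄.gammaOmega 𝒱 ⊆ 𝔄.lang) := by
  refine ⟨BuchiEffect.termEff 𝔄 P (.call f),
    𝔄.alphaOmega (BuchiEffect.Diverges P ∅ (.call f)), ?_, ?_⟩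
  · rw [← BuchiEffect.exactEnv_empty 𝔄 procVar P, ← BuchiEffect.alphaExpr_empty 𝔄 procVar]
    exact BuchiEffect.derives_exact 𝔄 procVar P ∅ (.call f)
  · rw [BuchiEffect.traces_eq_union, Set.union_subset_iff, Set.union_subset_iff,
      𝔄.gammaOmega_alphaOmega_subset_lang_iff, BuchiEffect.termEff,
      𝔄.gammaStar_alphaStar_subset_lang_iff (BuchiEffect.termLang P (.call f))]
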